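/- **Random representation gap under the manifold hypothesis.** Let $d\ge 1$ and let $\Omega$ be a compact $d$-dimensional smooth Riemannian manifold without boundary (not necessarily connected), with Riemannian volume measure $\mathrm{d}y$ and Riemannian distance $\mathrm{dist}$ (equal to $+\infty$ between points of different connected components). Let $p:\Omega\to\mathbb{R}$ be a continuous, strictly positive probability density with respect to $\mathrm{d}y$. For each $n$, let $\mathbb{D}_n=\{Z_1,\dots,Z_n\}$, where $Z_1,\dots,Z_n$ are i.i.d. random points of $\Omega$ with density $p$. For a set $S\subset\Omega$ of predictions let $$\mathcal{R}(\Omega,S)=\int_\Omega \inf_{z\in S}\mathrm{dist}(y,z)^2\,p(y)\,\mathrm{d}y\in[0,\infty]$$ be its representation gap, and let $\mathcal{R}_n=\mathcal{R}(\Omega,\mathbb{D}_n)$ be the random representation gap of a model that memorizes its training set, i.e. whose prediction space is $\mathbb{D}_n$ (equivalently, the nearest-neighbour quantization error of the sample). Then $$\mathcal{R}_n\;\sim_{\mathbb{P}}\;\frac{J_d\,\mathcal{V}_d(p)}{n^{2/d}}\qquad(n\to\infty),$$ where $$J_d=\frac1\pi\,\Gamma\!\left(1+\tfrac d2\right)^{2/d}\Gamma\!\left(1+\tfrac2d\right),\qquad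 \mathcal{V}_d(p)=\int_\Omega p(y)^{(d-2)/d}\,\mathrm{d}y,$$ and $X_n\sim_{\mathbb{P}}a_n$ means that $X_n/a_n\to1$ in probability. -/

import Mathlib

open MeasureTheory ProbabilityTheory Filter Topology Bundle
open scoped ENNReal Manifold ContDiff

noncomputable section

namespace RepresentationGap

section Volume

variable {d : ℕ} {M : Type*} [TopologicalSpace M] [ChartedSpace (EuclideanSpace ℝ (Fin d)) M]
  [RiemannianBundle (fun x : M => TangentSpace (𝓡 d) x)]

/-- The `i`-th coordinate vector field `∂ᵢ` of the chart at `x`, at the point with coordinates `u`: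
the image of the `i`-th standard basis vector under the derivative of the inverse chart. -/
def coordVector (x : M) (u : EuclideanSpace ℝ (Fin d)) (i : Fin d) :
    TangentSpace (𝓡 d) ((extChartAt (𝓡 d) x).symm u) :=
  mfderiv (𝓡 d) (𝓡 d) (extChartAt (𝓡 d) x).symm u (EuclideanSpace.single i (1 : ℝ))

/-- The Gram matrix `gᵢⱼ(u) = ⟨∂ᵢ, ∂ⱼ⟩` of the Riemannian metric in the chart at `x`. -/
def gramMatrix (x : M) (u : EuclideanSpace ℝ (Fin d)) : Matrix (Fin d) (Fin d) ℝ :=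
  Matrix.of fun i j => inner ℝ (coordVector x u i) (coordVector x u j)

variable [MeasurableSpace M]

/-- The Riemannian volume on the domain of the chart `φ` at `x` (extended by zero outside):
`A ↦ ∫_{φ(A ∩ dom φ)} √(det gᵢⱼ(u)) du`. -/
def chartVolume (x : M) : Measure M :=
  (((volume : Measure (EuclideanSpace ℝ (Fin d))).restrict (extChartAt (𝓡 d) x).target).withDensity
    (fun u => ENNReal.ofReal (Real.sqrt (gramMatrix x u).det))).map (extChartAt (𝓡 d) x).symm

variable (d M) in
/-- The Riemannian volume measure: the least measure that dominates the measures
`√(det gᵢⱼ) du` of all the charts. (By the change of variables formula these agree on overlaps of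
charts, so this is the measure that equals `√(det gᵢⱼ) du` on the domain of each chart.) -/
def riemannianVolume : Measure M := ⨆ x : M, chartVolume (d := d) x

end Volume

/-- The representation gap `∫ inf_{z ∈ S} ℓ(y, z) p(y) dy` of a prediction space `S`, for the
squared distance cost `ℓ`, the density `p` and the reference measure `vol`. It takes values in
`[0, ∞]`, and the distance between points in different connected components is infinite. -/
def representationGap {M : Type*} [EMetricSpace M] [MeasurableSpace M] (vol : Measure M)
    (p : M → ℝ) (S : Set M) : ℝ≥0∞ :=
  ∫⁻ y, (⨅ z ∈ S, edist y z ^ 2) * ENNReal.ofReal (p y) ∂vol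

/-- The constant `J_d = Γ(1 + d/2)^(2/d) Γ(1 + 2/d) / π`. -/
def constJ (d : ℕ) : ℝ :=
  1 / Real.pi * Real.Gamma (1 + (d : ℝ) / 2) ^ (2 / (d : ℝ)) * Real.Gamma (1 + 2 / (d : ℝ))

/-- The functional `V_d(p) = ∫ p^((d-2)/d)`. -/
def volumeFunctional {M : Type*} [MeasurableSpace M] (vol : Measure M) (d : ℕ) (p : M → ℝ) : ℝ :=
  ∫ x, p x ^ (((d : ℝ) - 2) / (d : ℝ)) ∂vol

/-- `X_n ∼_ℙ a_n`: the ratio `X_n / a_n` converges to `1` in probability. -/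
def EquivInProbability {Ω : Type*} [MeasurableSpace Ω] (P : Measure Ω) (X : ℕ → Ω → ℝ≥0∞)
    (a : ℕ → ℝ) : Prop :=
  TendstoInMeasure P (fun n w => X n w / ENNReal.ofReal (a n)) atTop (fun _ => 1)

end RepresentationGap

end

/-! Let μ be the law of density `p` and put b = n^(2/d). By the layer-cake formula, b·R_n is the
measure, under μ ⊗ Lebesgue on (0, ∞), of the pairs (y, s) such that no sample lies in the open ball
of radius √(s/b) around y. This random set is `uncovered`, up to the truncation s ≤ b·δ², which
keeps all radii below a fixed δ; with probability tending to 1 every point is within δ of a sample,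
and then the truncation removes nothing (`measure_section_uncovered`,
`tendsto_measure_not_covered`).

A ball of small radius r around y has mass about κ p(y) r^d, with κ the volume of the Euclidean unit
ball. So (y, s) is uncovered with probability (1 − κ p(y) s^(d/2)/n + o(1/n))^n → exp(−κ p(y)
s^(d/2)). For two distinct points the balls are eventually disjoint, so the joint probability tends
to the product of the limits. A uniform bound μ(B(y, r)) ≥ c r^d for r ≤ δ gives exponential
domination, so the first two moments of the measure of the random set converge to l and l², and
Chebyshev's inequality gives convergence in probability to l
(`tendsto_measure_le_abs_sub_measure_section`, assembled in `tendsto_measure_nearest_sample`).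

Integrating the limit in s gives (κ p(y))^(−2/d) Γ(1 + 2/d), and then against μ gives J_d V_d(p)
(`toReal_lintegral_exp_neg_eq`).

The geometric input is the mass of small balls. The chart at x, composed with a linear map making
the metric at x Euclidean, distorts distances and volumes near x by factors arbitrarily close to 1
(`edist_le_mul_edist_chart`, `edist_chart_le_mul_edist`, `eventually_volume_image_chart`). Hence
`eventually_riemannianVolume_eball`, from which both the local density and the uniform lower bound
follow. -/

namespace RepresentationGap

open Set

/-! ### The Riemannian metric read in a chart. -/

section Frame

variable {d : ℕ} {M : Type*} [TopologicalSpace M] [ChartedSpace (EuclideanSpace ℝ (Fin d)) M]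

/-- The derivative of the inverse chart at `x`, seen as an endomorphism of the model space. -/
noncomputable def chartFrame (x : M) (u : EuclideanSpace ℝ (Fin d)) :
    EuclideanSpace ℝ (Fin d) →L[ℝ] EuclideanSpace ℝ (Fin d) :=
  mfderiv (𝓡 d) (𝓡 d) (extChartAt (𝓡 d) x).symm u

/-- Transfers the norm estimates of a continuous Riemannian bundle, which are expressed in the
trivialization at `x`, to the coordinate frame of the chart at `x`. -/
lemma symmL_trivializationAt_eq_chartFrame [IsManifold (𝓡 d) 1 M] {x y : M}
    (hy : y ∈ (chartAt (EuclideanSpace ℝ (Fin d)) x).source) (v : EuclideanSpace ℝ (Fin d)) :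
    (trivializationAt (EuclideanSpace ℝ (Fin d)) (TangentSpace (𝓡 d)) x).symmL ℝ y v =
      chartFrame x (extChartAt (𝓡 d) x y) v := by
  rw [TangentBundle.symmL_trivializationAt hy, ModelWithCorners.range_eq_univ, mfderivWithin_univ]
  rfl

variable [RiemannianBundle (fun x : M => TangentSpace (𝓡 d) x)]

/-- The Riemannian scalar product at `y`, on the model space. -/
noncomputable def metricForm (y : M) (v w : EuclideanSpace ℝ (Fin d)) : ℝ :=
  inner ℝ (show TangentSpace (𝓡 d) y from v) (show TangentSpace (𝓡 d) y from w)

/-- The Riemannian norm at `y`, on the model space. -/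
noncomputable def metricNorm (y : M) (v : EuclideanSpace ℝ (Fin d)) : ℝ :=
  ‖(show TangentSpace (𝓡 d) y from v)‖

lemma gramMatrix_apply (x : M) (u : EuclideanSpace ℝ (Fin d)) (i j : Fin d) :
    gramMatrix x u i j = metricForm ((extChartAt (𝓡 d) x).symm u)
      (chartFrame x u (EuclideanSpace.single i 1)) (chartFrame x u (EuclideanSpace.single j 1)) :=
  rfl

lemma metricForm_self (y : M) (v : EuclideanSpace ℝ (Fin d)) :
    metricForm y v v = metricNorm y v ^ 2 :=
  real_inner_self_eq_norm_sq _

lemma metricNorm_nonneg (y : M) (v : EuclideanSpace ℝ (Fin d)) : 0 ≤ metricNorm y v :=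
  norm_nonneg _

lemma metricForm_add_left (y : M) (u v w : EuclideanSpace ℝ (Fin d)) :
    metricForm y (u + v) w = metricForm y u w + metricForm y v w :=
  inner_add_left _ _ _

lemma metricForm_smul_left (y : M) (a : ℝ) (v w : EuclideanSpace ℝ (Fin d)) :
    metricForm y (a • v) w = a * metricForm y v w :=
  real_inner_smul_left _ _ _

lemma metricForm_comm (y : M) (v w : EuclideanSpace ℝ (Fin d)) :
    metricForm y v w = metricForm y w v :=
  real_inner_comm _ _

/-- The Riemannian scalar product at `y`, as a bilinear form on the model space. -/
noncomputable def metricBilin (y : M) :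
    LinearMap.BilinForm ℝ (EuclideanSpace ℝ (Fin d)) :=
  LinearMap.mk₂ ℝ (metricForm y) (metricForm_add_left y) (metricForm_smul_left y)
    (fun u v w => by
      rw [metricForm_comm, metricForm_add_left, metricForm_comm y v, metricForm_comm y w])
    (fun a v w => by rw [metricForm_comm, metricForm_smul_left, metricForm_comm, smul_eq_mul])

variable [IsManifold (𝓡 d) 1 M]
  [IsContinuousRiemannianBundle (EuclideanSpace ℝ (Fin d)) (fun x : M => TangentSpace (𝓡 d) x)]

/-- Near `x`, the Riemannian metric in the chart at `x` is close to its value at `x`. -/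
lemma eventually_metricNorm_chartFrame (x : M) {K : ℝ} (hK : 1 < K) :
    ∀ᶠ y in 𝓝 x, ∀ v : EuclideanSpace ℝ (Fin d),
      metricNorm y (chartFrame x (extChartAt (𝓡 d) x y) v) ≤
        K * metricNorm x (chartFrame x (extChartAt (𝓡 d) x x) v) ∧
      metricNorm x (chartFrame x (extChartAt (𝓡 d) x x) v) ≤
        K * metricNorm y (chartFrame x (extChartAt (𝓡 d) x y) v) := by
  filter_upwards [chart_source_mem_nhds (EuclideanSpace ℝ (Fin d)) x,
    eventually_norm_symmL_trivializationAt_comp_self_lt (EuclideanSpace ℝ (Fin d))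
      (fun x : M => TangentSpace (𝓡 d) x) x hK,
    eventually_norm_symmL_trivializationAt_self_comp_lt (EuclideanSpace ℝ (Fin d))
      (fun x : M => TangentSpace (𝓡 d) x) x hK] with y hy h1 h2 v
  have hx := mem_chart_source (EuclideanSpace ℝ (Fin d)) x
  have key : ∀ z ∈ (chartAt (EuclideanSpace ℝ (Fin d)) x).source,
      (trivializationAt (EuclideanSpace ℝ (Fin d)) (TangentSpace (𝓡 d)) x).continuousLinearMapAt ℝ z
      ((trivializationAt (EuclideanSpace ℝ (Fin d)) (TangentSpace (𝓡 d)) x).symmL ℝ z v) = v := by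
    intro z hz
    exact Trivialization.continuousLinearMapAt_symmL _ (by simpa using hz) v
  constructor
  · have := ContinuousLinearMap.le_of_opNorm_le _ h1.le
      ((trivializationAt (EuclideanSpace ℝ (Fin d)) (TangentSpace (𝓡 d)) x).symmL ℝ x v)
    rw [ContinuousLinearMap.comp_apply, key x hx, symmL_trivializationAt_eq_chartFrame hx,
      symmL_trivializationAt_eq_chartFrame hy] at this
    exact this
  · have := ContinuousLinearMap.le_of_opNorm_le _ h2.le
      ((trivializationAt (EuclideanSpace ℝ (Fin d)) (TangentSpace (𝓡 d)) x).symmL ℝ y v)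
    rw [ContinuousLinearMap.comp_apply, key y hy, symmL_trivializationAt_eq_chartFrame hx,
      symmL_trivializationAt_eq_chartFrame hy] at this
    exact this

end Frame
lemma tendsto_of_forall_one_lt_mul {α : Type*} {l : Filter α} {u : α → ℝ} {a : ℝ} (ha : 0 ≤ a)
    (hu : ∀ x, 0 ≤ u x) (h : ∀ K > 1, ∀ᶠ x in l, u x ≤ K * a ∧ a ≤ K * u x) :
    Tendsto u l (𝓝 a) := by
  rw [Metric.tendsto_nhds]
  intro ε hε
  have hK : 1 < 1 + ε / (a + ε + 1) := by
    have : 0 < ε / (a + ε + 1) := by positivity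
    linarith
  filter_upwards [h _ hK] with x hx
  obtain ⟨h1, h2⟩ := hx
  have hx0 := hu x
  have h3 : ε / (a + ε + 1) * (a + ε + 1) = ε := by field_simp
  set t := ε / (a + ε + 1)
  have ht : 0 < t := by linarith
  rw [Real.dist_eq, abs_lt]
  have hbε : u x < a + ε := by nlinarith
  constructor <;> nlinarith

/-! ### Gram determinants and normalization of the metric at a point. -/

section Gram

variable {d : ℕ} {M : Type*} [TopologicalSpace M] [ChartedSpace (EuclideanSpace ℝ (Fin d)) M]

lemma chartFrame_injective [IsManifold (𝓡 d) 1 M] {x y : M}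
    (hy : y ∈ (chartAt (EuclideanSpace ℝ (Fin d)) x).source) :
    Function.Injective (chartFrame x (extChartAt (𝓡 d) x y)) := by
  have key : ∀ v,
      (trivializationAt (EuclideanSpace ℝ (Fin d)) (TangentSpace (𝓡 d)) x).continuousLinearMapAt ℝ y
      ((trivializationAt (EuclideanSpace ℝ (Fin d)) (TangentSpace (𝓡 d)) x).symmL ℝ y v) = v := by
    intro v
    exact Trivialization.continuousLinearMapAt_symmL _ (by simpa using hy) v
  intro v w hvw
  rw [← symmL_trivializationAt_eq_chartFrame hy, ← symmL_trivializationAt_eq_chartFrame hy] at hvw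
  rw [← key v, ← key w, hvw]

variable [RiemannianBundle (fun x : M => TangentSpace (𝓡 d) x)]

/-- The determinant of the Riemannian metric at `y`, in the standard basis of the model space. -/
noncomputable def metricDet (y : M) : ℝ :=
  (LinearMap.BilinForm.toMatrix (EuclideanSpace.basisFun (Fin d) ℝ).toBasis (metricBilin y)).det

lemma gramMatrix_eq_toMatrix (x : M) (u : EuclideanSpace ℝ (Fin d)) :
    gramMatrix x u = LinearMap.BilinForm.toMatrix (EuclideanSpace.basisFun (Fin d) ℝ).toBasis
      ((metricBilin (d := d) ((extChartAt (𝓡 d) x).symm u)).comp (chartFrame x u).toLinearMap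
        (chartFrame x u).toLinearMap) := by
  ext i j
  rw [LinearMap.BilinForm.toMatrix_apply, gramMatrix_apply]
  simp [metricBilin]

/-- The Gram matrix is the congruence of the matrix of the metric by that of the frame. The factor
`metricDet` depends only on the point of the manifold, so two charts differ only through the
determinants of their frames. -/
lemma det_gramMatrix (x : M) (u : EuclideanSpace ℝ (Fin d)) :
    (gramMatrix x u).det = (chartFrame x u).det ^ 2 * metricDet (d := d) ((extChartAt (𝓡 d) x).symm u) := by
  rw [gramMatrix_eq_toMatrix, LinearMap.BilinForm.toMatrix_comp (n := Fin d) (o := Fin d) _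
    (EuclideanSpace.basisFun (Fin d) ℝ).toBasis, Matrix.det_mul,
    Matrix.det_mul, Matrix.det_transpose, LinearMap.det_toMatrix, metricDet, ContinuousLinearMap.det]
  ring

/-- `L` is isometric from the metric at `x`, read in the chart at `x`, to the Euclidean metric. -/
def IsNormalizing (x : M) (L : EuclideanSpace ℝ (Fin d) ≃L[ℝ] EuclideanSpace ℝ (Fin d)) : Prop :=
  ∀ v w, inner ℝ (L v) (L w) = metricForm x (chartFrame x (extChartAt (𝓡 d) x x) v)
    (chartFrame x (extChartAt (𝓡 d) x x) w)

/-- The frame at the centre is injective; following it with coordinates in an orthonormal basis of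
the tangent space gives an injective endomorphism in finite dimension, hence an equivalence. -/
lemma exists_normalizing_equiv [IsManifold (𝓡 d) 1 M] (x : M) :
    ∃ L : EuclideanSpace ℝ (Fin d) ≃L[ℝ] EuclideanSpace ℝ (Fin d), IsNormalizing x L := by
  have : FiniteDimensional ℝ (TangentSpace (𝓡 d) x) :=
    inferInstanceAs (FiniteDimensional ℝ (EuclideanSpace ℝ (Fin d)))
  have hrank : Module.finrank ℝ (TangentSpace (𝓡 d) x) = d :=
    (finrank_euclideanSpace_fin : Module.finrank ℝ (EuclideanSpace ℝ (Fin d)) = d)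
  let e := ((stdOrthonormalBasis ℝ (TangentSpace (𝓡 d) x)).reindex (finCongr hrank)).repr
  let A : EuclideanSpace ℝ (Fin d) →ₗ[ℝ] TangentSpace (𝓡 d) x :=
    (chartFrame x (extChartAt (𝓡 d) x x)).toLinearMap
  have hinj : Function.Injective (e.toLinearEquiv.toLinearMap ∘ₗ A) :=
    e.injective.comp (chartFrame_injective (mem_chart_source _ x))
  refine ⟨(LinearEquiv.ofInjectiveEndo _ hinj).toContinuousLinearEquiv, fun v w => ?_⟩
  exact e.inner_map_map _ _

lemma metricNorm_eq_norm {x : M} {L : EuclideanSpace ℝ (Fin d) ≃L[ℝ] EuclideanSpace ℝ (Fin d)}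
    (hL : IsNormalizing x L) (v : EuclideanSpace ℝ (Fin d)) :
    metricNorm x (chartFrame x (extChartAt (𝓡 d) x x) v) = ‖L v‖ := by
  have := hL v v
  rw [metricForm_self, real_inner_self_eq_norm_sq] at this
  exact ((sq_eq_sq₀ (norm_nonneg _) (metricNorm_nonneg (d := d) _ _)).1 this).symm

lemma det_gramMatrix_center {x : M}
    {L : EuclideanSpace ℝ (Fin d) ≃L[ℝ] EuclideanSpace ℝ (Fin d)}
    (hL : IsNormalizing x L) :
    (gramMatrix x (extChartAt (𝓡 d) x x)).det =
      (L : EuclideanSpace ℝ (Fin d) →L[ℝ] EuclideanSpace ℝ (Fin d)).det ^ 2 := by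
  have : gramMatrix x (extChartAt (𝓡 d) x x) =
      LinearMap.BilinForm.toMatrix (EuclideanSpace.basisFun (Fin d) ℝ).toBasis
        (LinearMap.BilinForm.comp (innerₗ (EuclideanSpace ℝ (Fin d))) (L : EuclideanSpace ℝ (Fin d) →ₗ[ℝ] EuclideanSpace ℝ (Fin d))
        (L : EuclideanSpace ℝ (Fin d) →ₗ[ℝ] EuclideanSpace ℝ (Fin d))) := by
    ext i j
    rw [LinearMap.BilinForm.toMatrix_apply, gramMatrix_apply, extChartAt_to_inv]
    simp [hL (EuclideanSpace.single i 1) (EuclideanSpace.single j 1)]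
  have h1 : LinearMap.BilinForm.toMatrix (EuclideanSpace.basisFun (Fin d) ℝ).toBasis
      (innerₗ _ : LinearMap.BilinForm ℝ (EuclideanSpace ℝ (Fin d))) = 1 := by
    ext i j
    rw [LinearMap.BilinForm.toMatrix_apply]
    simp [Matrix.one_apply, EuclideanSpace.inner_single_left]
  rw [this, LinearMap.BilinForm.toMatrix_comp (n := Fin d) (o := Fin d) _
    (EuclideanSpace.basisFun (Fin d) ℝ).toBasis, h1, Matrix.det_mul,
    Matrix.det_mul, Matrix.det_transpose, LinearMap.det_toMatrix, ContinuousLinearMap.det,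
    Matrix.det_one]
  simp only [mul_one, sq]
  rfl

lemma metricForm_polarization (y : M) (v w : EuclideanSpace ℝ (Fin d)) :
    metricForm y v w = (metricNorm y (v + w) ^ 2 - metricNorm y v ^ 2 - metricNorm y w ^ 2) / 2 := by
  rw [← metricForm_self, ← metricForm_self, ← metricForm_self, metricForm_add_left,
    metricForm_comm y v (v + w), metricForm_comm y w (v + w), metricForm_add_left,
    metricForm_add_left, metricForm_comm y w v]
  ring

variable [IsManifold (𝓡 d) 1 M]
  [IsContinuousRiemannianBundle (EuclideanSpace ℝ (Fin d)) (fun x : M => TangentSpace (𝓡 d) x)]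

lemma tendsto_metricNorm_chartFrame (x : M) (v : EuclideanSpace ℝ (Fin d)) :
    Tendsto (fun y => metricNorm y (chartFrame x (extChartAt (𝓡 d) x y) v)) (𝓝 x)
      (𝓝 (metricNorm x (chartFrame x (extChartAt (𝓡 d) x x) v))) := by
  refine tendsto_of_forall_one_lt_mul (metricNorm_nonneg (d := d) _ _)
    (fun y => metricNorm_nonneg (d := d) _ _) fun K hK => ?_
  filter_upwards [eventually_metricNorm_chartFrame (d := d) x hK] with y hy using hy v

/-- The bundle estimates control norms only; polarization transfers the convergence to scalar
products. -/
lemma tendsto_gramMatrix (x : M) :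
    Tendsto (fun y => gramMatrix x (extChartAt (𝓡 d) x y)) (𝓝 x)
      (𝓝 (gramMatrix x (extChartAt (𝓡 d) x x))) := by
  refine tendsto_pi_nhds.2 fun i => tendsto_pi_nhds.2 fun j => ?_
  have hev : ∀ᶠ y in 𝓝 x, (extChartAt (𝓡 d) x).symm (extChartAt (𝓡 d) x y) = y := by
    filter_upwards [extChartAt_source_mem_nhds (I := 𝓡 d) x] with y hy
    exact (extChartAt (𝓡 d) x).left_inv hy
  have key : ∀ y, (extChartAt (𝓡 d) x).symm (extChartAt (𝓡 d) x y) = y →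
      gramMatrix x (extChartAt (𝓡 d) x y) i j =
      (metricNorm y (chartFrame x (extChartAt (𝓡 d) x y)
        (EuclideanSpace.single i 1 + EuclideanSpace.single j 1)) ^ 2
      - metricNorm y (chartFrame x (extChartAt (𝓡 d) x y) (EuclideanSpace.single i 1)) ^ 2
      - metricNorm y (chartFrame x (extChartAt (𝓡 d) x y) (EuclideanSpace.single j 1)) ^ 2) / 2 := by
    intro y hy
    rw [gramMatrix_apply, hy, metricForm_polarization, map_add]
  have := (((tendsto_metricNorm_chartFrame x
    (EuclideanSpace.single i 1 + EuclideanSpace.single j 1)).pow 2).sub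
    ((tendsto_metricNorm_chartFrame x (EuclideanSpace.single i 1)).pow 2)).sub
    ((tendsto_metricNorm_chartFrame x (EuclideanSpace.single j 1)).pow 2) |>.div_const 2
  rw [← key x (extChartAt_to_inv x)] at this
  refine this.congr' ?_
  filter_upwards [hev] with y hy
  exact (key y hy).symm

/-- Near `x`, the density of the volume in the chart at `x` is close to its value at `x`. -/
lemma eventually_sqrt_det_gramMatrix {x : M}
    {L : EuclideanSpace ℝ (Fin d) ≃L[ℝ] EuclideanSpace ℝ (Fin d)}
    (hL : IsNormalizing x L) {K : ℝ} (hK : 1 < K) :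
    ∀ᶠ y in 𝓝 x,
      √(gramMatrix x (extChartAt (𝓡 d) x y)).det ≤
        K * |(L : EuclideanSpace ℝ (Fin d) →L[ℝ] EuclideanSpace ℝ (Fin d)).det| ∧
      |(L : EuclideanSpace ℝ (Fin d) →L[ℝ] EuclideanSpace ℝ (Fin d)).det| ≤
        K * √(gramMatrix x (extChartAt (𝓡 d) x y)).det := by
  have h : Tendsto (fun y => √(gramMatrix x (extChartAt (𝓡 d) x y)).det) (𝓝 x)
      (𝓝 |(L : EuclideanSpace ℝ (Fin d) →L[ℝ] EuclideanSpace ℝ (Fin d)).det|) := by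
    have h1 := (Continuous.matrix_det (A := fun m : Matrix (Fin d) (Fin d) ℝ => m)
      continuous_id).continuousAt.tendsto.comp (tendsto_gramMatrix x)
    have h2 := (Real.continuous_sqrt.tendsto _).comp h1
    rw [det_gramMatrix_center hL, Real.sqrt_sq_eq_abs] at h2
    exact h2
  have hpos : 0 < |(L : EuclideanSpace ℝ (Fin d) →L[ℝ] EuclideanSpace ℝ (Fin d)).det| :=
    abs_pos.2 (LinearEquiv.isUnit_det' L.toLinearEquiv).ne_zero
  set D := |(L : EuclideanSpace ℝ (Fin d) →L[ℝ] EuclideanSpace ℝ (Fin d)).det|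
  filter_upwards [h.eventually (eventually_le_nhds (show D < K * D by nlinarith)),
    (h.const_mul K).eventually (eventually_ge_nhds (show D < K * D by nlinarith))] with y h1 h2
  exact ⟨h1, h2⟩

end Gram

/-! ### Near isometry of the normalized chart. -/

section Distance

open Manifold
open scoped NNReal

variable {d : ℕ} {M : Type*} [EMetricSpace M] [ChartedSpace (EuclideanSpace ℝ (Fin d)) M]
  [RiemannianBundle (fun x : M => TangentSpace (𝓡 d) x)] [IsManifold (𝓡 d) 1 M]

/-- Chain rule: it turns lengths of paths on the manifold into integrals of coordinate velocities.
-/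
lemma enorm_mfderivWithin_symm_comp {x : M} {c : ℝ → EuclideanSpace ℝ (Fin d)} {s : Set ℝ} {t : ℝ}
    (ht : c t ∈ (extChartAt (𝓡 d) x).target) (hc : DifferentiableWithinAt ℝ c s t)
    (hs : UniqueDiffWithinAt ℝ s t) :
    ‖mfderivWithin 𝓘(ℝ) (𝓡 d) ((extChartAt (𝓡 d) x).symm ∘ c) s t 1‖ₑ =
      ENNReal.ofReal (metricNorm ((extChartAt (𝓡 d) x).symm (c t))
        (chartFrame x (c t) (derivWithin c s t))) := by
  have hd : MDifferentiableAt (𝓡 d) (𝓡 d) (extChartAt (𝓡 d) x).symm (c t) := by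
    have := mdifferentiableWithinAt_extChartAt_symm (I := 𝓡 d) ht
    rwa [ModelWithCorners.range_eq_univ, mdifferentiableWithinAt_univ] at this
  have h1 : mfderivWithin 𝓘(ℝ) (𝓡 d) ((extChartAt (𝓡 d) x).symm ∘ c) s t =
      (mfderiv (𝓡 d) (𝓡 d) (extChartAt (𝓡 d) x).symm (c t)) ∘L
        (mfderivWithin 𝓘(ℝ) (𝓡 d) c s t) :=
    mfderiv_comp_mfderivWithin _ hd hc.mdifferentiableWithinAt hs.uniqueMDiffWithinAt
  have h2 : mfderivWithin 𝓘(ℝ) (𝓡 d) ((extChartAt (𝓡 d) x).symm ∘ c) s t 1 =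
      chartFrame x (c t) (derivWithin c s t) := by
    rw [h1, mfderivWithin_eq_fderivWithin, ← fderivWithin_derivWithin]
    rfl
  rw [← ofReal_norm]
  exact congrArg ENNReal.ofReal
    (congrArg (metricNorm (d := d) ((extChartAt (𝓡 d) x).symm (c t))) h2)

lemma eventually_metricNorm_chartFrame_le_norm
    [IsContinuousRiemannianBundle (EuclideanSpace ℝ (Fin d)) (fun x : M => TangentSpace (𝓡 d) x)]
    {x : M} {L : EuclideanSpace ℝ (Fin d) ≃L[ℝ] EuclideanSpace ℝ (Fin d)} (hL : IsNormalizing x L)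
    {K : ℝ} (hK : 1 < K) :
    ∀ᶠ y in 𝓝 x, ∀ v : EuclideanSpace ℝ (Fin d),
      metricNorm y (chartFrame x (extChartAt (𝓡 d) x y) v) ≤ K * ‖L v‖ ∧
      ‖L v‖ ≤ K * metricNorm y (chartFrame x (extChartAt (𝓡 d) x y) v) := by
  filter_upwards [eventually_metricNorm_chartFrame (d := d) x hK] with y hy v
  rw [← metricNorm_eq_norm hL]
  exact hy v

variable [IsContinuousRiemannianBundle (EuclideanSpace ℝ (Fin d))
    (fun x : M => TangentSpace (𝓡 d) x)] [IsRiemannianManifold (𝓡 d) M]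

/-- The Riemannian distance is at most the length of the path whose coordinates run along a straight
segment. The segment stays in a coordinate ball by convexity, and there the metric is within a
factor `K` of its value at `x`. -/
lemma edist_le_mul_edist_chart {x : M}
    {L : EuclideanSpace ℝ (Fin d) ≃L[ℝ] EuclideanSpace ℝ (Fin d)} (hL : IsNormalizing x L)
    {K : ℝ} (hK : 1 < K) :
    ∃ U ∈ 𝓝 x, ∀ y ∈ U, ∀ z ∈ U, edist y z ≤ ENNReal.ofReal K *
      edist (L (extChartAt (𝓡 d) x y)) (L (extChartAt (𝓡 d) x z)) := by
  set φ := extChartAt (𝓡 d) x with hφ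
  have hV := eventually_metricNorm_chartFrame_le_norm hL hK
  have hcont : ContinuousAt φ.symm (φ x) := continuousAt_extChartAt_symm x
  have hV' : ∀ᶠ u in 𝓝 (φ x), ∀ v : EuclideanSpace ℝ (Fin d),
      metricNorm (φ.symm u) (chartFrame x (φ (φ.symm u)) v) ≤ K * ‖L v‖ := by
    have h0 : φ.symm (φ x) = x := extChartAt_to_inv x
    refine hcont.eventually (p := fun y => ∀ v : EuclideanSpace ℝ (Fin d),
      metricNorm y (chartFrame x (φ y) v) ≤ K * ‖L v‖) ?_
    rw [h0]
    exact hV.mono fun y hy v => (hy v).1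
  obtain ⟨r, r_pos, hr⟩ := Metric.eventually_nhds_iff_ball.1
    (hV'.and (extChartAt_target_mem_nhds (I := 𝓡 d) x))
  refine ⟨φ.source ∩ φ ⁻¹' Metric.ball (φ x) r, inter_mem (extChartAt_source_mem_nhds x)
    ((continuousAt_extChartAt x).preimage_mem_nhds (Metric.ball_mem_nhds _ r_pos)), ?_⟩
  rintro y ⟨hys, hyb⟩ z ⟨hzs, hzb⟩
  let η := ContinuousAffineMap.lineMap (R := ℝ) (φ y) (φ z)
  have hη : ∀ t ∈ Icc (0 : ℝ) 1, η t ∈ Metric.ball (φ x) r := by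
    intro t ht
    apply (convex_ball (φ x) r).segment_subset hyb hzb
    rw [segment_eq_image_lineMap]
    exact ⟨t, ht, by simp [η, ContinuousAffineMap.coe_lineMap_eq]⟩
  have hηd : ∀ t ∈ Icc (0 : ℝ) 1, derivWithin η (Icc 0 1) t = φ z - φ y := by
    intro t ht
    have h1 : HasDerivAt η (φ z - φ y) t := by
      simpa [η, ContinuousAffineMap.coe_lineMap_eq] using
        AffineMap.hasDerivAt_lineMap (𝕜 := ℝ) (a := φ y) (b := φ z) (x := t)
    exact h1.hasDerivWithinAt.derivWithin (uniqueDiffOn_Icc zero_lt_one t ht)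
  have η_smooth : ContMDiffOn 𝓘(ℝ) (𝓡 d) 1 η (Icc 0 1) := by
    apply ContMDiff.contMDiffOn
    rw [contMDiff_iff_contDiff]
    exact ContinuousAffineMap.contDiff _
  have h1 : riemannianEDist (𝓡 d) y z ≤ pathELength (𝓡 d) (φ.symm ∘ η) 0 1 := by
    apply riemannianEDist_le_pathELength _ _ _ zero_le_one
    · exact (contMDiffOn_extChartAt_symm x).comp η_smooth fun t ht => (hr _ (hη t ht)).2
    · simpa [η, ContinuousAffineMap.coe_lineMap_eq] using φ.left_inv hys
    · simpa [η, ContinuousAffineMap.coe_lineMap_eq] using φ.left_inv hzs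
  rw [IsRiemannianManifold.out (I := 𝓡 d) y z]
  refine h1.trans ?_
  rw [pathELength_eq_lintegral_mfderivWithin_Icc, edist_comm, edist_eq_enorm_sub, ← map_sub]
  calc ∫⁻ t in Icc (0 : ℝ) 1, ‖mfderivWithin 𝓘(ℝ) (𝓡 d) (φ.symm ∘ η) (Icc 0 1) t 1‖ₑ
      ≤ ∫⁻ t in Icc (0 : ℝ) 1, ENNReal.ofReal K * ‖L (φ z - φ y)‖ₑ := by
        refine setLIntegral_mono' measurableSet_Icc fun t ht => ?_
        have hb := hr _ (hη t ht)
        rw [enorm_mfderivWithin_symm_comp hb.2 η.differentiableAt.differentiableWithinAt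
          (uniqueDiffOn_Icc zero_lt_one t ht), hηd t ht, ← ofReal_norm,
          ← ENNReal.ofReal_mul (by linarith)]
        refine ENNReal.ofReal_le_ofReal ?_
        have := hb.1 (φ z - φ y)
        rwa [φ.right_inv hb.2] at this
    _ = ENNReal.ofReal K * ‖L (φ z - φ y)‖ₑ := by simp

/-- An almost minimizing path between two points very close to `x` cannot leave the region where the
metric is within a factor `K` of its value at `x`; its image in the normalized chart is then at most
`K` times longer, and bounds the Euclidean distance. -/
lemma edist_chart_le_mul_edist {x : M}
    {L : EuclideanSpace ℝ (Fin d) ≃L[ℝ] EuclideanSpace ℝ (Fin d)} (hL : IsNormalizing x L)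
    {K : ℝ} (hK : 1 < K) :
    ∃ U ∈ 𝓝 x, ∀ y ∈ U, ∀ z ∈ U,
      edist (L (extChartAt (𝓡 d) x y)) (L (extChartAt (𝓡 d) x z)) ≤
        ENNReal.ofReal K * edist y z := by
  set φ := extChartAt (𝓡 d) x with hφ
  obtain ⟨ρ, ρ_pos, hρ⟩ := EMetric.mem_nhds_iff.1
    ((eventually_metricNorm_chartFrame_le_norm hL hK).and
      (extChartAt_source_mem_nhds (I := 𝓡 d) x))
  have ρ4 : 0 < ρ / 4 := ENNReal.div_pos ρ_pos.ne' (by simp)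
  -- Points of this ball are at distance less than `ρ / 2`, and a path of length less than `ρ / 2`
  -- starting in it stays in the ball of radius `ρ` around `x`.
  refine ⟨Metric.eball x (ρ / 4), Metric.eball_mem_nhds x ρ4, fun y hy z hz => ?_⟩
  rw [Metric.mem_eball] at hy hz
  have hyz : edist y z < ρ / 2 := by
    calc edist y z ≤ edist y x + edist z x := edist_triangle_right _ _ _
      _ < ρ / 4 + ρ / 4 := ENNReal.add_lt_add hy hz
      _ = ρ / 2 := by
        rw [← two_mul, ← mul_div_assoc, mul_comm, show (4 : ℝ≥0∞) = 2 * 2 by norm_num]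
        exact ENNReal.mul_div_mul_right _ _ (by simp) (by simp)
  have hK0 : ENNReal.ofReal K ≠ 0 := by
    rw [Ne, ENNReal.ofReal_eq_zero, not_le]; linarith
  -- The length bound `b` decreases to the distance; capping it at `ρ / 2` keeps the path in the
  -- good region.
  suffices h : ∀ b, edist y z < b → b ≤ ρ / 2 →
      edist (L (φ y)) (L (φ z)) ≤ ENNReal.ofReal K * b by
    rw [mul_comm, ← ENNReal.div_le_iff hK0 ENNReal.ofReal_ne_top]
    refine le_of_forall_gt_imp_ge_of_dense fun b hb => ?_
    rw [ENNReal.div_le_iff hK0 ENNReal.ofReal_ne_top, mul_comm]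
    exact (h (min b (ρ / 2)) (lt_min hb hyz) (min_le_right _ _)).trans
      (by gcongr; exact min_le_left _ _)
  intro b hb hbρ
  rw [IsRiemannianManifold.out (I := 𝓡 d) y z] at hb
  obtain ⟨γ, hγ0, hγ1, γ_smooth, hγ, -, -⟩ :=
    exists_lt_locally_constant_of_riemannianEDist_lt hb zero_lt_one
  have hγmem : ∀ t ∈ Icc (0 : ℝ) 1, γ t ∈ Metric.eball x ρ := by
    intro t ht
    have h1 : edist y (γ t) < ρ / 2 := by
      rw [IsRiemannianManifold.out (I := 𝓡 d) y (γ t)]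
      refine (riemannianEDist_le_pathELength γ_smooth.contMDiffOn hγ0 rfl ht.1).trans_lt ?_
      exact ((pathELength_mono le_rfl ht.2).trans_lt hγ).trans_le hbρ
    rw [Metric.mem_eball]
    calc edist (γ t) x ≤ edist y (γ t) + edist y x := edist_triangle_left _ _ _
      _ < ρ / 2 + ρ / 4 := ENNReal.add_lt_add h1 hy
      _ ≤ ρ / 2 + ρ / 2 := by gcongr; norm_num
      _ = ρ := ENNReal.add_halves _
  have hsrc : ∀ t ∈ Icc (0 : ℝ) 1, γ t ∈ φ.source := fun t ht => (hρ (hγmem t ht)).2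
  have hc : ContDiffOn ℝ 1 (φ ∘ γ) (Icc 0 1) := by
    rw [← contMDiffOn_iff_contDiffOn]
    exact contMDiffOn_extChartAt.comp (t := (chartAt (EuclideanSpace ℝ (Fin d)) x).source)
      γ_smooth.contMDiffOn fun t ht => by simpa [hφ] using hsrc t ht
  have hLc : ContDiffOn ℝ 1 (L ∘ φ ∘ γ) (Icc 0 1) := L.contDiff.comp_contDiffOn hc
  have hE : EqOn γ (φ.symm ∘ (φ ∘ γ)) (Icc 0 1) := fun t ht => (φ.left_inv (hsrc t ht)).symm
  have key := enorm_sub_le_lintegral_derivWithin_Icc_of_contDiffOn_Icc hLc zero_le_one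
  have hends : edist (L (φ y)) (L (φ z)) = ‖(L ∘ φ ∘ γ) 1 - (L ∘ φ ∘ γ) 0‖ₑ := by
    rw [edist_comm, edist_eq_enorm_sub]
    simp [hγ0, hγ1]
  rw [hends]
  refine key.trans ?_
  calc ∫⁻ t in Icc (0 : ℝ) 1, ‖derivWithin (L ∘ φ ∘ γ) (Icc 0 1) t‖ₑ
      ≤ ∫⁻ t in Icc (0 : ℝ) 1, ENNReal.ofReal K *
          ‖mfderivWithin 𝓘(ℝ) (𝓡 d) (φ.symm ∘ (φ ∘ γ)) (Icc 0 1) t 1‖ₑ := by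
        refine setLIntegral_mono' measurableSet_Icc fun t ht => ?_
        have hu := uniqueDiffOn_Icc (zero_lt_one' ℝ) t ht
        have hcd := hc.differentiableOn one_ne_zero t ht
        rw [enorm_mfderivWithin_symm_comp (φ.map_source (hsrc t ht)) hcd hu,
          ← ENNReal.ofReal_mul (by linarith), ← ofReal_norm]
        refine ENNReal.ofReal_le_ofReal ?_
        have h1 : derivWithin (L ∘ φ ∘ γ) (Icc 0 1) t = L (derivWithin (φ ∘ γ) (Icc 0 1) t) :=
          (L.hasFDerivAt.comp_hasDerivWithinAt t hcd.hasDerivWithinAt).derivWithin hu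
        rw [h1, Function.comp_apply, φ.left_inv (hsrc t ht)]
        exact ((hρ (hγmem t ht)).1 _).2
    _ = ENNReal.ofReal K * pathELength (𝓡 d) (φ.symm ∘ (φ ∘ γ)) 0 1 := by
        rw [lintegral_const_mul' _ _ ENNReal.ofReal_ne_top,
          pathELength_eq_lintegral_mfderivWithin_Icc]
    _ ≤ ENNReal.ofReal K * b := by
        rw [← pathELength_congr hE]
        gcongr

end Distance

/-! ### The Riemannian volume in charts. -/

section ChartVolume

variable {d : ℕ} {M : Type*} [TopologicalSpace M] [ChartedSpace (EuclideanSpace ℝ (Fin d)) M]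

lemma differentiableAt_transition [IsManifold (𝓡 d) 1 M] {x x' : M} {u : EuclideanSpace ℝ (Fin d)}
    (hu : u ∈ (extChartAt (𝓡 d) x).target)
    (hu' : (extChartAt (𝓡 d) x).symm u ∈ (extChartAt (𝓡 d) x').source) :
    DifferentiableAt ℝ (extChartAt (𝓡 d) x' ∘ (extChartAt (𝓡 d) x).symm) u := by
  have h := hasFDerivWithinAt_tangentCoordChange (I := 𝓡 d) (x := x) (y := x')
    (z := (extChartAt (𝓡 d) x).symm u) ⟨(extChartAt (𝓡 d) x).map_target hu, hu'⟩
  rw [(extChartAt (𝓡 d) x).right_inv hu, ModelWithCorners.range_eq_univ,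
    hasFDerivWithinAt_univ] at h
  exact h.differentiableAt

/-- Chain rule for the change of charts; it supplies the Jacobian that makes the chart volumes
consistent. -/
lemma chartFrame_eq_comp_fderiv [IsManifold (𝓡 d) 1 M] {x x' : M} {u : EuclideanSpace ℝ (Fin d)}
    (hu : u ∈ (extChartAt (𝓡 d) x).target)
    (hu' : (extChartAt (𝓡 d) x).symm u ∈ (extChartAt (𝓡 d) x').source) :
    chartFrame x u = chartFrame x' (extChartAt (𝓡 d) x' ((extChartAt (𝓡 d) x).symm u)) ∘L
      fderiv ℝ (extChartAt (𝓡 d) x' ∘ (extChartAt (𝓡 d) x).symm) u := by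
  have hev : (extChartAt (𝓡 d) x).symm =ᶠ[𝓝 u] (extChartAt (𝓡 d) x').symm ∘
      (extChartAt (𝓡 d) x' ∘ (extChartAt (𝓡 d) x).symm) := by
    have hc : ContinuousAt (extChartAt (𝓡 d) x).symm u := continuousAt_extChartAt_symm'' hu
    filter_upwards [hc.preimage_mem_nhds
      ((isOpen_extChartAt_source (I := 𝓡 d) x').mem_nhds hu')] with w hw
    exact ((extChartAt (𝓡 d) x').left_inv hw).symm
  have hd : MDifferentiableAt (𝓡 d) (𝓡 d) (extChartAt (𝓡 d) x').symm
      ((extChartAt (𝓡 d) x' ∘ (extChartAt (𝓡 d) x).symm) u) := by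
    have := mdifferentiableWithinAt_extChartAt_symm (I := 𝓡 d)
      ((extChartAt (𝓡 d) x').map_source hu')
    rwa [ModelWithCorners.range_eq_univ, mdifferentiableWithinAt_univ] at this
  have h1 := mfderiv_comp u hd (differentiableAt_transition hu hu').mdifferentiableAt
  have h2 : mfderiv (𝓡 d) (𝓡 d) (extChartAt (𝓡 d) x).symm u = _ := hev.mfderiv_eq
  rw [mfderiv_eq_fderiv] at h1
  ext1 v
  have h3 : mfderiv (𝓡 d) (𝓡 d) (extChartAt (𝓡 d) x).symm u v = _ :=
    congrArg (fun f : EuclideanSpace ℝ (Fin d) →L[ℝ] EuclideanSpace ℝ (Fin d) => f v) h2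
  have h4 := congrArg (fun f : EuclideanSpace ℝ (Fin d) →L[ℝ] EuclideanSpace ℝ (Fin d) => f v) h1
  exact h3.trans h4

lemma measurableSet_target_inter_preimage [MeasurableSpace M] [BorelSpace M] (x : M) {A : Set M}
    (hA : MeasurableSet A) :
    MeasurableSet ((extChartAt (𝓡 d) x).target ∩ (extChartAt (𝓡 d) x).symm ⁻¹' A) := by
  have h1 : Measurable ((extChartAt (𝓡 d) x).target.domRestrict (extChartAt (𝓡 d) x).symm) :=
    (continuousOn_extChartAt_symm x).domRestrict.measurable
  have h2 := (isOpen_extChartAt_target (I := 𝓡 d) x).measurableSet.subtype_image (h1 hA)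
  rwa [Set.domRestrict_eq, Set.preimage_comp, Subtype.image_preimage_coe] at h2

variable [RiemannianBundle (fun x : M => TangentSpace (𝓡 d) x)]

lemma chartVolume_apply [MeasurableSpace M] [BorelSpace M] (x : M) {A : Set M}
    (hA : MeasurableSet A) :
    chartVolume (d := d) x A =
      ∫⁻ u in (extChartAt (𝓡 d) x).target ∩ (extChartAt (𝓡 d) x).symm ⁻¹' A,
        ENNReal.ofReal √(gramMatrix x u).det := by
  have ht := (isOpen_extChartAt_target (I := 𝓡 d) x).measurableSet
  have hS := measurableSet_target_inter_preimage (d := d) x hA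
  have hac := withDensity_absolutelyContinuous
    ((volume : Measure (EuclideanSpace ℝ (Fin d))).restrict (extChartAt (𝓡 d) x).target)
    (fun u => ENNReal.ofReal √(gramMatrix x u).det)
  have hm : AEMeasurable (extChartAt (𝓡 d) x).symm
      (((volume : Measure (EuclideanSpace ℝ (Fin d))).restrict
        (extChartAt (𝓡 d) x).target).withDensity
        (fun u => ENNReal.ofReal √(gramMatrix x u).det)) :=
    ((continuousOn_extChartAt_symm x).aemeasurable ht).mono_ac hac
  rw [chartVolume, Measure.map_apply_of_aemeasurable hm hA]
  -- Outside the target the inverse chart takes arbitrary values, but the measure does not charge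
  -- that region.
  have hae : ((extChartAt (𝓡 d) x).symm ⁻¹' A : Set (EuclideanSpace ℝ (Fin d))) =ᵐ[
      ((volume : Measure (EuclideanSpace ℝ (Fin d))).restrict
        (extChartAt (𝓡 d) x).target).withDensity
        (fun u => ENNReal.ofReal √(gramMatrix x u).det)]
      ((extChartAt (𝓡 d) x).target ∩ (extChartAt (𝓡 d) x).symm ⁻¹' A : Set _) := by
    filter_upwards [hac.ae_le (ae_restrict_mem ht)] with u hu
    exact propext ⟨fun h => ⟨hu, h⟩, fun h => h.2⟩
  rw [measure_congr hae, withDensity_apply _ hS, Measure.restrict_restrict hS,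
    inter_eq_left.2 inter_subset_left]

lemma chartVolume_inter_source [MeasurableSpace M] [BorelSpace M] (x : M) {A : Set M}
    (hA : MeasurableSet A) :
    chartVolume (d := d) x (A ∩ (extChartAt (𝓡 d) x).source) = chartVolume (d := d) x A := by
  rw [chartVolume_apply x hA,
    chartVolume_apply x (hA.inter (isOpen_extChartAt_source (I := 𝓡 d) x).measurableSet)]
  congr 2
  ext u
  exact ⟨fun h => ⟨h.1, h.2.1⟩, fun h => ⟨h.1, h.2, (extChartAt (𝓡 d) x).map_target h.1⟩⟩

lemma sqrt_det_gramMatrix (x : M) (u : EuclideanSpace ℝ (Fin d)) :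
    √(gramMatrix x u).det =
      |(chartFrame x u).det| * √(metricDet (d := d) ((extChartAt (𝓡 d) x).symm u)) := by
  rw [det_gramMatrix, Real.sqrt_mul (sq_nonneg _), Real.sqrt_sq_eq_abs]

variable [IsManifold (𝓡 d) 1 M]

variable [MeasurableSpace M] [BorelSpace M]

/-- The volumes of two charts agree on the overlap. -/
lemma chartVolume_eq_chartVolume (x x' : M) {A : Set M} (hA : MeasurableSet A)
    (hAx : A ⊆ (extChartAt (𝓡 d) x).source) (hAx' : A ⊆ (extChartAt (𝓡 d) x').source) :
    chartVolume (d := d) x' A = chartVolume (d := d) x A := by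
  rw [chartVolume_apply x hA, chartVolume_apply x' hA]
  set S := (extChartAt (𝓡 d) x).target ∩ (extChartAt (𝓡 d) x).symm ⁻¹' A with hS
  set τ := extChartAt (𝓡 d) x' ∘ (extChartAt (𝓡 d) x).symm with hτ
  have himg : (extChartAt (𝓡 d) x').target ∩ (extChartAt (𝓡 d) x').symm ⁻¹' A = τ '' S := by
    rw [← PartialEquiv.image_eq_target_inter_inv_preimage _ hAx', hτ, image_comp, hS,
      ← PartialEquiv.image_eq_target_inter_inv_preimage _ hAx,
      (extChartAt (𝓡 d) x).symm_image_image_of_subset_source hAx]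
  have hinj : InjOn τ S := by
    intro u hu w hw huw
    have h1 := (extChartAt (𝓡 d) x').injOn (hAx' hu.2) (hAx' hw.2) huw
    exact (extChartAt (𝓡 d) x).symm.injOn hu.1 hw.1 h1
  rw [himg, lintegral_image_eq_lintegral_abs_det_fderiv_mul volume
    (measurableSet_target_inter_preimage x hA) (fun u hu =>
      (differentiableAt_transition hu.1 (hAx' hu.2)).hasFDerivAt.hasFDerivWithinAt) hinj]
  -- By the chain rule, the Jacobian of the transition times the frame determinant of one chart is
  -- the frame determinant of the other; the factor `metricDet` is common to both.
  refine setLIntegral_congr_fun (measurableSet_target_inter_preimage x hA) fun u hu => ?_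
  have hdet : ∀ f g : EuclideanSpace ℝ (Fin d) →L[ℝ] EuclideanSpace ℝ (Fin d),
      (f ∘L g).det = f.det * g.det := fun f g => LinearMap.det_comp _ _
  rw [sqrt_det_gramMatrix, sqrt_det_gramMatrix, chartFrame_eq_comp_fderiv hu.1 (hAx' hu.2),
    ← ENNReal.ofReal_mul (abs_nonneg _), hdet, abs_mul, Function.comp_apply, (extChartAt (𝓡 d) x').left_inv (hAx' hu.2)]
  congr 1
  ring

/-- On the domain of a chart, the Riemannian volume is the volume of this chart. -/
lemma riemannianVolume_apply_of_subset_source (x : M) {A : Set M} (hA : MeasurableSet A)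
    (hAx : A ⊆ (extChartAt (𝓡 d) x).source) :
    riemannianVolume d M A = chartVolume (d := d) x A := by
  have hs := (isOpen_extChartAt_source (I := 𝓡 d) x).measurableSet
  refine le_antisymm ?_ (le_iSup (fun y : M => chartVolume (d := d) y) x A)
  -- A supremum of measures is not computed set by set. It is enough to find one measure above all
  -- chart volumes that coincides with `chartVolume x` inside the domain of the chart.
  have hle : riemannianVolume d M ≤ chartVolume (d := d) x +
      (riemannianVolume d M).restrict (extChartAt (𝓡 d) x).sourceᶜ := by
    refine iSup_le fun x' => Measure.le_iff.2 fun B hB => ?_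
    have hs' := (isOpen_extChartAt_source (I := 𝓡 d) x').measurableSet
    rw [← measure_inter_add_sdiff B hs, Measure.add_apply, Measure.restrict_apply hB]
    refine add_le_add ?_ ?_
    · rw [← chartVolume_inter_source x' (hB.inter hs),
        chartVolume_eq_chartVolume x x' ((hB.inter hs).inter hs')
          (inter_subset_left.trans inter_subset_right) inter_subset_right]
      exact measure_mono (inter_subset_left.trans inter_subset_left)
    · exact le_iSup (fun y : M => chartVolume (d := d) y) x' _
  refine (hle A).trans ?_
  rw [Measure.add_apply, Measure.restrict_apply hA]
  have : A ∩ (extChartAt (𝓡 d) x).sourceᶜ = ∅ := by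
    rw [← sdiff_eq, sdiff_eq_empty]; exact hAx
  rw [this, measure_empty, add_zero]

/-- Near `x`, the normalized chart at `x` almost preserves the volume. -/
lemma eventually_volume_image_chart
    [IsContinuousRiemannianBundle (EuclideanSpace ℝ (Fin d)) (fun x : M => TangentSpace (𝓡 d) x)]
    {x : M} {L : EuclideanSpace ℝ (Fin d) ≃L[ℝ] EuclideanSpace ℝ (Fin d)} (hL : IsNormalizing x L)
    {K : ℝ} (hK : 1 < K) :
    ∃ U ∈ 𝓝 x, ∀ A ⊆ U, MeasurableSet A →
      riemannianVolume d M A ≤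
        ENNReal.ofReal K * volume ((fun y => L (extChartAt (𝓡 d) x y)) '' A) ∧
      volume ((fun y => L (extChartAt (𝓡 d) x y)) '' A) ≤
        ENNReal.ofReal K * riemannianVolume d M A := by
  refine ⟨_, (eventually_sqrt_det_gramMatrix hL hK).and
    (extChartAt_source_mem_nhds (I := 𝓡 d) x), fun A hAU hA => ?_⟩
  have hAx : A ⊆ (extChartAt (𝓡 d) x).source := fun y hy => (hAU hy).2
  have hK0 : 0 ≤ K := by linarith
  set D := |(L : EuclideanSpace ℝ (Fin d) →L[ℝ] EuclideanSpace ℝ (Fin d)).det| with hD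
  set S := (extChartAt (𝓡 d) x).target ∩ (extChartAt (𝓡 d) x).symm ⁻¹' A with hS
  have hSm : MeasurableSet S := measurableSet_target_inter_preimage x hA
  have himg : volume ((fun y => L (extChartAt (𝓡 d) x y)) '' A) =
      ENNReal.ofReal D * volume S := by
    have h1 := Measure.addHaar_image_continuousLinearMap
      (volume : Measure (EuclideanSpace ℝ (Fin d)))
      (L : EuclideanSpace ℝ (Fin d) →L[ℝ] EuclideanSpace ℝ (Fin d)) S
    rw [hD, ← h1, hS, ← PartialEquiv.image_eq_target_inter_inv_preimage _ hAx, ← image_comp]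
    rfl
  have hbd : ∀ u ∈ S, √(gramMatrix x u).det ≤ K * D ∧ D ≤ K * √(gramMatrix x u).det := by
    intro u hu
    have := (hAU hu.2).1
    rwa [(extChartAt (𝓡 d) x).right_inv hu.1] at this
  rw [himg, riemannianVolume_apply_of_subset_source x hA hAx, chartVolume_apply x hA]
  constructor
  · calc ∫⁻ u in S, ENNReal.ofReal √(gramMatrix x u).det
        ≤ ∫⁻ u in S, ENNReal.ofReal (K * D) :=
          setLIntegral_mono' hSm fun u hu => ENNReal.ofReal_le_ofReal (hbd u hu).1
      _ = ENNReal.ofReal K * (ENNReal.ofReal D * volume S) := by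
          rw [setLIntegral_const, ENNReal.ofReal_mul hK0, mul_assoc]
  · calc ENNReal.ofReal D * volume S = ∫⁻ u in S, ENNReal.ofReal D := by
          rw [setLIntegral_const]
      _ ≤ ∫⁻ u in S, ENNReal.ofReal K * ENNReal.ofReal √(gramMatrix x u).det := by
          refine setLIntegral_mono' hSm fun u hu => ?_
          rw [← ENNReal.ofReal_mul hK0]
          exact ENNReal.ofReal_le_ofReal (hbd u hu).2
      _ = _ := lintegral_const_mul' _ _ ENNReal.ofReal_ne_top

end ChartVolume

/-! ### Volume of small balls. -/

section Ball

variable {d : ℕ} {M : Type*} [EMetricSpace M] [ChartedSpace (EuclideanSpace ℝ (Fin d)) M]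
  [RiemannianBundle (fun x : M => TangentSpace (𝓡 d) x)] [IsManifold (𝓡 d) 1 M]
  [IsContinuousRiemannianBundle (EuclideanSpace ℝ (Fin d)) (fun x : M => TangentSpace (𝓡 d) x)]
  [IsRiemannianManifold (𝓡 d) M] [MeasurableSpace M] [BorelSpace M]

/-- Small balls around the points close to `x` have almost the volume of Euclidean balls. -/
lemma eventually_riemannianVolume_eball (x : M) {K : ℝ} (hK : 1 < K) :
    ∃ r₀ > 0, ∀ᶠ z in 𝓝 x, ∀ r, 0 < r → r ≤ r₀ →
      riemannianVolume d M (Metric.eball z (ENNReal.ofReal r)) ≤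
        ENNReal.ofReal (K ^ (d + 1) * r ^ d) *
          volume (Metric.ball (0 : EuclideanSpace ℝ (Fin d)) 1) ∧
      ENNReal.ofReal (r ^ d) * volume (Metric.ball (0 : EuclideanSpace ℝ (Fin d)) 1) ≤
        ENNReal.ofReal (K ^ (d + 1)) *
          riemannianVolume d M (Metric.eball z (ENNReal.ofReal r)) := by
  have hK0 : 0 < K := by linarith
  obtain ⟨L, hL⟩ := exists_normalizing_equiv (d := d) x
  obtain ⟨U₁, hU₁, h₁⟩ := edist_le_mul_edist_chart hL hK
  obtain ⟨U₂, hU₂, h₂⟩ := edist_chart_le_mul_edist hL hK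
  obtain ⟨U₃, hU₃, h₃⟩ := eventually_volume_image_chart hL hK
  have hU : U₁ ∩ U₂ ∩ U₃ ∈ 𝓝 x := inter_mem (inter_mem hU₁ hU₂) hU₃
  set Φ : M → EuclideanSpace ℝ (Fin d) := fun y => L (extChartAt (𝓡 d) x y) with hΦ
  have hΦc : ContinuousAt Φ x := L.continuous.continuousAt.comp (continuousAt_extChartAt x)
  have hΦU : Φ '' (U₁ ∩ U₂ ∩ U₃) ∈ 𝓝 (Φ x) := by
    have h := extChartAt_image_nhds_mem_nhds_of_boundaryless (I := 𝓡 d) hU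
    have h' := L.toHomeomorph.isOpenMap.image_mem_nhds h
    rw [← image_comp] at h'
    exact h'
  obtain ⟨ρ, ρ_pos, hρ⟩ := EMetric.mem_nhds_iff.1 hU
  obtain ⟨s, s_pos, hs⟩ := Metric.mem_nhds_iff.1 hΦU
  obtain ⟨r₁, hr₁0, hr₁⟩ : ∃ r₁ : ℝ, 0 < r₁ ∧ ENNReal.ofReal r₁ + ENNReal.ofReal r₁ ≤ ρ := by
    obtain ⟨q, hq0, hq⟩ := ENNReal.lt_iff_exists_nnreal_btwn.1 (ENNReal.half_pos ρ_pos.ne')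
    refine ⟨q, by exact_mod_cast hq0, ?_⟩
    rw [ENNReal.ofReal_coe_nnreal]
    exact (add_le_add hq.le hq.le).trans_eq (ENNReal.add_halves ρ)
  -- The bound `r₁` keeps the Riemannian balls inside the good neighbourhood of `x`; `s / 2` keeps
  -- the Euclidean balls inside its image.
  refine ⟨min r₁ (s / 2), lt_min hr₁0 (by positivity), ?_⟩
  filter_upwards [Metric.eball_mem_nhds x (ENNReal.ofReal_pos.2 hr₁0),
    hΦc.preimage_mem_nhds (Metric.ball_mem_nhds _ (half_pos s_pos))] with z hz hzΦ r hr hr₀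
  have hrr₁ : r ≤ r₁ := hr₀.trans (min_le_left _ _)
  have hrs : r ≤ s / 2 := hr₀.trans (min_le_right _ _)
  have hball : Metric.eball z (ENNReal.ofReal r) ⊆ U₁ ∩ U₂ ∩ U₃ := by
    intro y hy
    apply hρ
    rw [Metric.mem_eball] at hy hz ⊢
    exact (edist_triangle _ z _).trans_lt ((ENNReal.add_lt_add hy hz).trans_le
      ((add_le_add_left (ENNReal.ofReal_le_ofReal hrr₁) _).trans hr₁))
  have hzU : z ∈ U₁ ∩ U₂ ∩ U₃ := hball (Metric.mem_eball_self (ENNReal.ofReal_pos.2 hr))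
  obtain ⟨hv1, hv2⟩ := h₃ _ (hball.trans inter_subset_right) Metric.isOpen_eball.measurableSet
  have hvol : ∀ (w : EuclideanSpace ℝ (Fin d)) (t : ℝ), 0 < t → volume (Metric.ball w t) =
      ENNReal.ofReal (t ^ d) * volume (Metric.ball (0 : EuclideanSpace ℝ (Fin d)) 1) := by
    intro w t ht
    rw [Measure.addHaar_ball_of_pos _ _ ht, finrank_euclideanSpace_fin]
  constructor
  -- In `K ^ (d + 1)`, `d` factors come from the distortion of the radius and one from that of the
  -- volume.
  · have hsub : Φ '' Metric.eball z (ENNReal.ofReal r) ⊆ Metric.ball (Φ z) (K * r) := by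
      rintro _ ⟨y, hy, rfl⟩
      rw [← Metric.eball_ofReal, Metric.mem_eball]
      refine (h₂ y (hball hy).1.2 z hzU.1.2).trans_lt ?_
      rw [ENNReal.ofReal_mul hK0.le]
      exact ENNReal.mul_lt_mul_right (ENNReal.ofReal_pos.2 hK0).ne' ENNReal.ofReal_ne_top hy
    calc riemannianVolume d M (Metric.eball z (ENNReal.ofReal r))
        ≤ ENNReal.ofReal K * volume (Metric.ball (Φ z) (K * r)) := by
          refine hv1.trans ?_
          gcongr
      _ = _ := by
          rw [hvol _ _ (by positivity), ← mul_assoc, ← ENNReal.ofReal_mul hK0.le]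
          congr 2
          ring
  · have hsub : Metric.ball (Φ z) (r / K) ⊆ Φ '' Metric.eball z (ENNReal.ofReal r) := by
      intro v hv
      have hvs : v ∈ Metric.ball (Φ x) s := by
        have h1 : dist v (Φ z) < r / K := hv
        have h2 : dist (Φ z) (Φ x) < s / 2 := hzΦ
        have h3 : r / K ≤ r := div_le_self hr.le hK.le
        rw [Metric.mem_ball]
        linarith [dist_triangle v (Φ z) (Φ x)]
      obtain ⟨y, hy, rfl⟩ := hs hvs
      refine ⟨y, ?_, rfl⟩
      rw [Metric.mem_eball]
      refine (h₁ y hy.1.1 z hzU.1.1).trans_lt ?_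
      rw [← Metric.eball_ofReal, Metric.mem_eball] at hv
      have h4 : r = K * (r / K) := by field_simp
      rw [h4, ENNReal.ofReal_mul hK0.le]
      exact ENNReal.mul_lt_mul_right (ENNReal.ofReal_pos.2 hK0).ne' ENNReal.ofReal_ne_top hv
    have h5 := (measure_mono hsub).trans hv2
    rw [hvol _ _ (by positivity)] at h5
    calc ENNReal.ofReal (r ^ d) * volume (Metric.ball (0 : EuclideanSpace ℝ (Fin d)) 1)
        = ENNReal.ofReal (K ^ d) * (ENNReal.ofReal ((r / K) ^ d) *
            volume (Metric.ball (0 : EuclideanSpace ℝ (Fin d)) 1)) := by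
          rw [← mul_assoc, ← ENNReal.ofReal_mul (by positivity), ← mul_pow]
          congr 3
          field_simp
      _ ≤ ENNReal.ofReal (K ^ d) * (ENNReal.ofReal K *
            riemannianVolume d M (Metric.eball z (ENNReal.ofReal r))) := by gcongr
      _ = _ := by
          rw [← mul_assoc, ← ENNReal.ofReal_mul (by positivity), ← pow_succ]

end Ball

/-! ### Second moment method for random sets. -/

section SecondMoment

variable {Ω Q : Type*} [MeasurableSpace Ω] [MeasurableSpace Q]

/-- The squared measure of a section is the `ν.prod ν` measure of its square; then Tonelli. -/
lemma lintegral_measure_section_sq {P : Measure Ω} [SFinite P] {ν : Measure Q} [SFinite ν]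
    {E : Set (Ω × Q)} (hE : MeasurableSet E) :
    ∫⁻ w, ν (Prod.mk w ⁻¹' E) ^ 2 ∂P =
      ∫⁻ z, P ({w | (w, z.1) ∈ E ∧ (w, z.2) ∈ E}) ∂(ν.prod ν) := by
  have hE2 : MeasurableSet {z : Ω × (Q × Q) | (z.1, z.2.1) ∈ E ∧ (z.1, z.2.2) ∈ E} :=
    ((by fun_prop : Measurable fun z : Ω × (Q × Q) => (z.1, z.2.1)) hE).inter
      ((by fun_prop : Measurable fun z : Ω × (Q × Q) => (z.1, z.2.2)) hE)
  have h1 := Measure.prod_apply (μ := P) (ν := ν.prod ν) hE2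
  rw [Measure.prod_apply_symm hE2] at h1
  refine Eq.trans ?_ h1.symm
  refine lintegral_congr fun w => ?_
  rw [sq, ← Measure.prod_prod]
  rfl

/-- Chebyshev centred at the limit: E(S − l)² = E S² − 2 l E S + l² tends to l² − 2l² + l² = 0. -/
lemma tendsto_measure_le_abs_sub_of_tendsto_moments {P : Measure Ω} [IsProbabilityMeasure P]
    {S : ℕ → Ω → ℝ≥0∞} (hS : ∀ n, Measurable (S n)) {l : ℝ≥0∞} (hl : l ≠ ⊤)
    (h1 : Tendsto (fun n => ∫⁻ w, S n w ∂P) atTop (𝓝 l))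
    (h2 : Tendsto (fun n => ∫⁻ w, S n w ^ 2 ∂P) atTop (𝓝 (l ^ 2))) {ε : ℝ} (hε : 0 < ε) :
    Tendsto (fun n => P {w | ε ≤ |(S n w).toReal - l.toReal|}) atTop (𝓝 0) := by
  have hl2 : l ^ 2 ≠ ⊤ := by finiteness
  have hf : ∀ᶠ n in atTop, ∫⁻ w, S n w ∂P ≠ ⊤ ∧ ∫⁻ w, S n w ^ 2 ∂P ≠ ⊤ :=
    (h1.eventually_ne hl).and (h2.eventually_ne hl2)
  have h1' := (ENNReal.tendsto_toReal hl).comp h1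
  have h2' := (ENNReal.tendsto_toReal hl2).comp h2
  have h3 : Tendsto (fun n => ENNReal.ofReal (((∫⁻ w, S n w ^ 2 ∂P).toReal
      - 2 * l.toReal * (∫⁻ w, S n w ∂P).toReal + l.toReal ^ 2) / ε ^ 2)) atTop (𝓝 0) := by
    have h4 := ENNReal.tendsto_ofReal
      (((h2'.sub (h1'.const_mul (2 * l.toReal))).add_const (l.toReal ^ 2)).div_const (ε ^ 2))
    have h5 : ENNReal.ofReal (((l ^ 2).toReal - 2 * l.toReal * l.toReal + l.toReal ^ 2) / ε ^ 2)
        = 0 := by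
      rw [ENNReal.toReal_pow]
      ring_nf
      simp
    rwa [h5] at h4
  refine tendsto_of_tendsto_of_tendsto_of_le_of_le' tendsto_const_nhds h3
    (Eventually.of_forall fun n => zero_le) ?_
  filter_upwards [hf] with n hn
  obtain ⟨hn1, hn2⟩ := hn
  have hae1 : ∀ᵐ w ∂P, S n w < ⊤ := ae_lt_top (hS n) hn1
  have i1 : Integrable (fun w => (S n w).toReal) P :=
    integrable_toReal_of_lintegral_ne_top (hS n).aemeasurable hn1
  have i2 : Integrable (fun w => (S n w).toReal ^ 2) P := by
    have := integrable_toReal_of_lintegral_ne_top ((hS n).pow_const 2).aemeasurable hn2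
    simpa [ENNReal.toReal_pow] using this
  have e1 : ∫ w, (S n w).toReal ∂P = (∫⁻ w, S n w ∂P).toReal :=
    integral_toReal (hS n).aemeasurable hae1
  have e2 : ∫ w, (S n w).toReal ^ 2 ∂P = (∫⁻ w, S n w ^ 2 ∂P).toReal := by
    have := integral_toReal (μ := P) ((hS n).pow_const 2).aemeasurable
      (by filter_upwards [hae1] with w hw using ENNReal.pow_lt_top hw)
    simpa [ENNReal.toReal_pow] using this
  have i3 : Integrable (fun w => ((S n w).toReal - l.toReal) ^ 2) P := by
    have := (i2.sub (i1.const_mul (2 * l.toReal))).add (integrable_const (l.toReal ^ 2))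
    refine this.congr (Eventually.of_forall fun w => ?_)
    simp only [Pi.add_apply, Pi.sub_apply]
    ring
  have e3 : ∫ w, ((S n w).toReal - l.toReal) ^ 2 ∂P = (∫⁻ w, S n w ^ 2 ∂P).toReal
      - 2 * l.toReal * (∫⁻ w, S n w ∂P).toReal + l.toReal ^ 2 := by
    have hexp : ∀ w, ((S n w).toReal - l.toReal) ^ 2 =
        (S n w).toReal ^ 2 - 2 * l.toReal * (S n w).toReal + l.toReal ^ 2 := fun w => by ring
    have i4 : Integrable (fun w => (S n w).toReal ^ 2 - 2 * l.toReal * (S n w).toReal) P :=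
      i2.sub (i1.const_mul _)
    simp_rw [hexp]
    rw [integral_add i4 (integrable_const _),
      integral_sub i2 (i1.const_mul _), integral_const_mul, e1, e2]
    simp
  have hmark := mul_meas_ge_le_integral_of_nonneg
    (Eventually.of_forall fun w => sq_nonneg ((S n w).toReal - l.toReal)) i3 (ε ^ 2)
  rw [e3] at hmark
  have hsub : {w | ε ≤ |(S n w).toReal - l.toReal|} ⊆
      {w | ε ^ 2 ≤ ((S n w).toReal - l.toReal) ^ 2} := by
    intro w hw
    have hw' : ε ≤ |(S n w).toReal - l.toReal| := hw
    change ε ^ 2 ≤ ((S n w).toReal - l.toReal) ^ 2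
    rw [← sq_abs ((S n w).toReal - l.toReal)]
    gcongr
  refine (measure_mono hsub).trans ?_
  rw [← ENNReal.ofReal_toReal (measure_ne_top P _)]
  refine ENNReal.ofReal_le_ofReal ?_
  rw [le_div_iff₀ (by positivity), mul_comm]
  exact hmark

/-- A second moment argument: the measure of the sections of random sets converges in probability
if pairs of points are asymptotically independent. -/
lemma tendsto_measure_le_abs_sub_measure_section {P : Measure Ω} [IsProbabilityMeasure P]
    {ν : Measure Q} [SigmaFinite ν] {E : ℕ → Set (Ω × Q)} (hE : ∀ n, MeasurableSet (E n))
    {g G : Q → ℝ≥0∞} (hg : Measurable g) (hG : Measurable G) (hG_fin : ∫⁻ q, G q ∂ν ≠ ⊤)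
    (hdom1 : ∀ n, ∀ᵐ q ∂ν, P {w | (w, q) ∈ E n} ≤ G q)
    (hlim1 : ∀ᵐ q ∂ν, Tendsto (fun n => P {w | (w, q) ∈ E n}) atTop (𝓝 (g q)))
    (hdom2 : ∀ n q q', P {w | (w, q) ∈ E n ∧ (w, q') ∈ E n} ≤ G q * G q')
    (hlim2 : ∀ᵐ z ∂(ν.prod ν), Tendsto (fun n => P {w | (w, z.1) ∈ E n ∧ (w, z.2) ∈ E n}) atTop
      (𝓝 (g z.1 * g z.2))) {ε : ℝ} (hε : 0 < ε) :
    Tendsto (fun n => P {w | ε ≤ |(ν (Prod.mk w ⁻¹' E n)).toReal - (∫⁻ q, g q ∂ν).toReal|})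
      atTop (𝓝 0) := by
  have hm1 : ∀ n, Measurable fun q => P {w | (w, q) ∈ E n} := fun n =>
    measurable_measure_prodMk_right (hE n)
  have hm2 : ∀ n, Measurable fun z : Q × Q => P {w | (w, z.1) ∈ E n ∧ (w, z.2) ∈ E n} := by
    intro n
    have hE2 : MeasurableSet {z : Ω × (Q × Q) | (z.1, z.2.1) ∈ E n ∧ (z.1, z.2.2) ∈ E n} :=
      ((by fun_prop : Measurable fun z : Ω × (Q × Q) => (z.1, z.2.1)) (hE n)).inter
        ((by fun_prop : Measurable fun z : Ω × (Q × Q) => (z.1, z.2.2)) (hE n))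
    exact measurable_measure_prodMk_right hE2
  have hl1 := tendsto_lintegral_of_dominated_convergence G hm1
    hdom1 hG_fin hlim1
  have hG2 : ∫⁻ z, G z.1 * G z.2 ∂(ν.prod ν) ≠ ⊤ := by
    rw [lintegral_prod_mul hG.aemeasurable hG.aemeasurable]
    exact ENNReal.mul_ne_top hG_fin hG_fin
  have hl2 := tendsto_lintegral_of_dominated_convergence (fun z : Q × Q => G z.1 * G z.2) hm2
    (fun n => Eventually.of_forall fun z => hdom2 n z.1 z.2) hG2 hlim2
  rw [lintegral_prod_mul hg.aemeasurable hg.aemeasurable, ← sq] at hl2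
  have hgG : ∫⁻ q, g q ∂ν ≠ ⊤ := by
    refine ne_top_of_le_ne_top hG_fin (lintegral_mono_ae ?_)
    filter_upwards [hlim1, ae_all_iff.2 hdom1] with q hq hq1
    exact le_of_tendsto' hq hq1
  refine tendsto_measure_le_abs_sub_of_tendsto_moments
    (fun n => measurable_measure_prodMk_left (hE n)) hgG ?_ ?_ hε
  · refine hl1.congr fun n => ?_
    rw [← Measure.prod_apply (hE n), Measure.prod_apply_symm (hE n)]
    rfl
  · refine hl2.congr fun n => ?_
    rw [lintegral_measure_section_sq (hE n)]

end SecondMoment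

/-! ### Probability that a set contains no sample. -/

section Samples

lemma tendsto_one_sub_pow_exp_neg {a : ℕ → ℝ} {t : ℝ}
    (h : Tendsto (fun n : ℕ => n * a n) atTop (𝓝 t)) :
    Tendsto (fun n : ℕ => (1 - a n) ^ n) atTop (𝓝 (Real.exp (-t))) := by
  have := Real.tendsto_one_add_pow_exp_of_tendsto (g := fun n => -a n) (t := -t)
    (by simpa using h.neg)
  simpa [sub_eq_add_neg] using this

lemma one_sub_pow_le_exp {a : ℝ} (ha : a ≤ 1) (n : ℕ) : (1 - a) ^ n ≤ Real.exp (-(n * a)) := by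
  calc (1 - a) ^ n ≤ Real.exp (-a) ^ n :=
        pow_le_pow_left₀ (by linarith) (Real.one_sub_le_exp_neg a) n
    _ = _ := by rw [← Real.exp_nat_mul]; ring_nf

lemma measure_forall_notMem {Ω M : Type*} [MeasurableSpace Ω] [MeasurableSpace M]
    {P : Measure Ω} {μ : Measure M} [IsProbabilityMeasure μ] {n : ℕ}
    {Z : Fin n → Ω → M} (hZ_law : ∀ i, HasLaw (Z i) μ P) (hZ_indep : iIndepFun Z P)
    {B : Set M} (hB : MeasurableSet B) :
    P {w | ∀ i, Z i w ∉ B} = ENNReal.ofReal ((1 - μ.real B) ^ n) := by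
  have h1 := hZ_indep.measure_inter_preimage_eq_mul Finset.univ (sets := fun _ => Bᶜ)
    (fun i _ => hB.compl)
  have h2 : (⋂ i ∈ (Finset.univ : Finset (Fin n)), Z i ⁻¹' Bᶜ) = {w | ∀ i, Z i w ∉ B} := by
    ext w; simp
  have h3 : ∀ i, P (Z i ⁻¹' Bᶜ) = μ Bᶜ := by
    intro i
    rw [← (hZ_law i).map_eq, Measure.map_apply_of_aemeasurable (hZ_law i).aemeasurable hB.compl]
  rw [h2] at h1
  rw [h1, Finset.prod_congr rfl fun i _ => h3 i, Finset.prod_const, Finset.card_univ,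
    Fintype.card_fin, ENNReal.ofReal_pow (by linarith [measureReal_le_one (μ := μ) (s := B)]),
    ← probReal_compl_eq_one_sub hB, ofReal_measureReal]

end Samples
-- Explains the scale n^(2/d): at squared radius s / n^(2/d), the quantity n·r^d does not depend on
-- n.
lemma sqrt_div_rpow_pow_mul {d : ℕ} (hd : 0 < d) {n : ℕ} (hn : 0 < n) {s : ℝ} (hs : 0 < s) :
    n * √(s / (n : ℝ) ^ (2 / (d : ℝ))) ^ d = s ^ ((d : ℝ) / 2) := by
  have hn' : (0 : ℝ) < n := by exact_mod_cast hn
  have hd' : (0 : ℝ) < d := by exact_mod_cast hd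
  have hx : 0 ≤ s / (n : ℝ) ^ (2 / (d : ℝ)) := by positivity
  rw [Real.sqrt_eq_rpow, ← Real.rpow_natCast, ← Real.rpow_mul hx,
    Real.div_rpow hs.le (by positivity), ← Real.rpow_mul hn'.le]
  have h1 : 2 / (d : ℝ) * (1 / 2 * d) = 1 := by field_simp
  have h2 : 1 / 2 * (d : ℝ) = d / 2 := by ring
  rw [h1, h2, Real.rpow_one]
  field_simp

lemma tendsto_sqrt_div_rpow {d : ℕ} (hd : 0 < d) {s : ℝ} (hs : 0 < s) :
    Tendsto (fun n : ℕ => √(s / (n : ℝ) ^ (2 / (d : ℝ)))) atTop (𝓝[>] 0) := by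
  have hd' : (0 : ℝ) < d := by exact_mod_cast hd
  refine tendsto_nhdsWithin_iff.2 ⟨?_, ?_⟩
  · have h1 : Tendsto (fun n : ℕ => (n : ℝ) ^ (2 / (d : ℝ))) atTop atTop :=
      (tendsto_rpow_atTop (by positivity)).comp tendsto_natCast_atTop_atTop
    have h2 := (Real.continuous_sqrt.tendsto 0).comp (h1.const_div_atTop s)
    rwa [Real.sqrt_zero] at h2
  · filter_upwards [eventually_gt_atTop 0] with n hn
    have hn' : (0 : ℝ) < n := by exact_mod_cast hn
    exact Real.sqrt_pos.2 (by positivity)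

/-! ### Uncovered pairs: domination and limits. -/

section Coverage

variable {M Ω : Type*} [EMetricSpace M] [MeasurableSpace Ω]

/-- The set of `(w, (y, s))` such that no sample lies in the ball of squared radius `s / b` around
`y`, for radii up to `δ`. -/
def uncovered {n : ℕ} (Z : Fin n → Ω → M) (b δ : ℝ) : Set (Ω × (M × ℝ)) :=
  {z | (0 < z.2.2 ∧ z.2.2 ≤ b * δ ^ 2) ∧
    ∀ i, ENNReal.ofReal √(z.2.2 / b) ≤ edist z.2.1 (Z i z.1)}

lemma measurableSet_uncovered [CompactSpace M] [MeasurableSpace M] [BorelSpace M] {n : ℕ}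
    {Z : Fin n → Ω → M} (hZ : ∀ i, Measurable (Z i)) (b δ : ℝ) :
    MeasurableSet (uncovered Z b δ) := by
  have hs : Measurable fun z : Ω × (M × ℝ) => z.2.2 := by fun_prop
  refine ((measurableSet_lt measurable_const hs).inter
    (measurableSet_le hs measurable_const)).inter ?_
  change MeasurableSet {z : Ω × (M × ℝ) | ∀ i,
    ENNReal.ofReal √(z.2.2 / b) ≤ edist z.2.1 (Z i z.1)}
  rw [ofPred_forall]
  refine MeasurableSet.iInter fun i => measurableSet_le ?_ ?_
  · exact ENNReal.measurable_ofReal.comp (Real.continuous_sqrt.measurable.comp (hs.div_const b))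
  · exact Measurable.edist (by fun_prop) ((hZ i).comp measurable_fst)

omit [MeasurableSpace Ω] in
lemma mem_uncovered_iff {n : ℕ} {Z : Fin n → Ω → M} {b δ : ℝ} {w : Ω} {q : M × ℝ} :
    (w, q) ∈ uncovered Z b δ ↔ (0 < q.2 ∧ q.2 ≤ b * δ ^ 2) ∧
      ∀ i, Z i w ∉ Metric.eball q.1 (ENNReal.ofReal √(q.2 / b)) := by
  simp only [uncovered, mem_ofPred_eq, Metric.mem_eball, not_lt, edist_comm]

variable [MeasurableSpace M] [BorelSpace M] {μ : Measure M} [IsProbabilityMeasure μ]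
  {P : Measure Ω}

lemma measure_uncovered {n : ℕ} {Z : Fin n → Ω → M} (hZ_law : ∀ i, HasLaw (Z i) μ P)
    (hZ_indep : iIndepFun Z P) {b δ : ℝ} {q : M × ℝ} (hq : 0 < q.2 ∧ q.2 ≤ b * δ ^ 2) :
    P {w | (w, q) ∈ uncovered Z b δ} =
      ENNReal.ofReal ((1 - μ.real (Metric.eball q.1 (ENNReal.ofReal √(q.2 / b)))) ^ n) := by
  rw [← measure_forall_notMem hZ_law hZ_indep Metric.isOpen_eball.measurableSet]
  congr 1
  ext w
  simp only [mem_ofPred_eq, mem_uncovered_iff, hq, and_self, true_and]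

lemma measure_uncovered_inter {n : ℕ} {Z : Fin n → Ω → M} (hZ_law : ∀ i, HasLaw (Z i) μ P)
    (hZ_indep : iIndepFun Z P) {b δ : ℝ} {q q' : M × ℝ} (hq : 0 < q.2 ∧ q.2 ≤ b * δ ^ 2)
    (hq' : 0 < q'.2 ∧ q'.2 ≤ b * δ ^ 2) :
    P {w | (w, q) ∈ uncovered Z b δ ∧ (w, q') ∈ uncovered Z b δ} =
      ENNReal.ofReal ((1 - μ.real (Metric.eball q.1 (ENNReal.ofReal √(q.2 / b)) ∪
        Metric.eball q'.1 (ENNReal.ofReal √(q'.2 / b)))) ^ n) := by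
  rw [← measure_forall_notMem hZ_law hZ_indep
    (Metric.isOpen_eball.union Metric.isOpen_eball).measurableSet]
  congr 1
  ext w
  simp only [mem_ofPred_eq, mem_uncovered_iff, hq, hq', and_self, true_and, mem_union, not_or,
    forall_and]

/-- Exponential domination of the probability that two balls are not covered. -/
lemma measure_uncovered_inter_le {d : ℕ} (hd : 0 < d) {c δ : ℝ} (hδ : 0 < δ)
    (hlow : ∀ (y : M) (r : ℝ), 0 < r → r ≤ δ →
      c * r ^ d ≤ μ.real (Metric.eball y (ENNReal.ofReal r)))
    {n : ℕ} {Z : Fin n → Ω → M} (hZ_law : ∀ i, HasLaw (Z i) μ P) (hZ_indep : iIndepFun Z P)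
    (q q' : M × ℝ) :
    P {w | (w, q) ∈ uncovered Z ((n : ℝ) ^ (2 / (d : ℝ))) δ ∧
        (w, q') ∈ uncovered Z ((n : ℝ) ^ (2 / (d : ℝ))) δ} ≤
      ENNReal.ofReal (Real.exp (-(c / 2 * q.2 ^ ((d : ℝ) / 2)))) *
        ENNReal.ofReal (Real.exp (-(c / 2 * q'.2 ^ ((d : ℝ) / 2)))) := by
  set b := (n : ℝ) ^ (2 / (d : ℝ)) with hb
  -- Outside the truncation range the event is empty.
  by_cases h : (0 < q.2 ∧ q.2 ≤ b * δ ^ 2) ∧ (0 < q'.2 ∧ q'.2 ≤ b * δ ^ 2)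
  swap
  · have : {w | (w, q) ∈ uncovered Z b δ ∧ (w, q') ∈ uncovered Z b δ} = ∅ := by
      ext w
      simp only [mem_uncovered_iff, mem_ofPred_eq, mem_empty_iff_false, iff_false]
      tauto
    rw [this, measure_empty]
    exact zero_le
  obtain ⟨hq, hq'⟩ := h
  have hd' : (0 : ℝ) < d := by exact_mod_cast hd
  -- For `n = 0` the scale is a positive power of zero, hence zero, and the truncation range is
  -- empty.
  have hn : 0 < n := by
    rcases Nat.eq_zero_or_pos n with h0 | h0
    · rw [h0, Nat.cast_zero, Real.zero_rpow (by positivity)] at hb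
      rw [hb, zero_mul] at hq
      linarith [hq.1, hq.2]
    · exact h0
  have hn' : (0 : ℝ) < n := by exact_mod_cast hn
  have hb0 : 0 < b := by positivity
  have key : ∀ q : M × ℝ, 0 < q.2 ∧ q.2 ≤ b * δ ^ 2 → c * q.2 ^ ((d : ℝ) / 2) ≤
      n * μ.real (Metric.eball q.1 (ENNReal.ofReal √(q.2 / b))) := by
    intro q hq
    rw [← sqrt_div_rpow_pow_mul hd hn hq.1, ← hb, mul_left_comm]
    refine mul_le_mul_of_nonneg_left (hlow _ _ (Real.sqrt_pos.2 (div_pos hq.1 hb0)) ?_) hn'.le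
    rw [Real.sqrt_le_left hδ.le, div_le_iff₀ hb0, mul_comm]
    exact hq.2
  rw [measure_uncovered_inter hZ_law hZ_indep hq hq',
    ← ENNReal.ofReal_mul (Real.exp_nonneg _), ← Real.exp_add]
  refine ENNReal.ofReal_le_ofReal ((one_sub_pow_le_exp measureReal_le_one n).trans ?_)
  refine Real.exp_le_exp.2 ?_
  -- The balls may overlap, but their union has at least the average of the two masses; this is the
  -- origin of `c / 2`.
  have h1 := key q hq
  have h2 := key q' hq'
  have h3 : (n : ℝ) * μ.real (Metric.eball q.1 (ENNReal.ofReal √(q.2 / b))) ≤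
      n * μ.real (Metric.eball q.1 (ENNReal.ofReal √(q.2 / b)) ∪
        Metric.eball q'.1 (ENNReal.ofReal √(q'.2 / b))) :=
    mul_le_mul_of_nonneg_left (measureReal_mono subset_union_left) hn'.le
  have h4 : (n : ℝ) * μ.real (Metric.eball q'.1 (ENNReal.ofReal √(q'.2 / b))) ≤
      n * μ.real (Metric.eball q.1 (ENNReal.ofReal √(q.2 / b)) ∪
        Metric.eball q'.1 (ENNReal.ofReal √(q'.2 / b))) :=
    mul_le_mul_of_nonneg_left (measureReal_mono subset_union_right) hn'.le
  linarith

omit [BorelSpace M] [IsProbabilityMeasure μ] in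
lemma tendsto_mul_measureReal_eball {d : ℕ} (hd : 0 < d) {y : M} {a : ℝ}
    (ha : Tendsto (fun r : ℝ => μ.real (Metric.eball y (ENNReal.ofReal r)) / r ^ d) (𝓝[>] 0) (𝓝 a))
    {s : ℝ} (hs : 0 < s) :
    Tendsto (fun n : ℕ => n * μ.real (Metric.eball y
      (ENNReal.ofReal √(s / (n : ℝ) ^ (2 / (d : ℝ)))))) atTop (𝓝 (a * s ^ ((d : ℝ) / 2))) := by
  refine ((ha.comp (tendsto_sqrt_div_rpow hd hs)).mul_const (s ^ ((d : ℝ) / 2))).congr' ?_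
  filter_upwards [eventually_gt_atTop 0] with n hn
  have hn' : (0 : ℝ) < n := by exact_mod_cast hn
  have hpos : 0 < √(s / (n : ℝ) ^ (2 / (d : ℝ))) := Real.sqrt_pos.2 (by positivity)
  rw [← sqrt_div_rpow_pow_mul hd hn hs, Function.comp_apply]
  field_simp

lemma eventually_le_rpow_mul_sq {d : ℕ} (hd : 0 < d) {δ : ℝ} (hδ : 0 < δ) (s : ℝ) :
    ∀ᶠ n : ℕ in atTop, s ≤ (n : ℝ) ^ (2 / (d : ℝ)) * δ ^ 2 := by
  have hd' : (0 : ℝ) < d := by exact_mod_cast hd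
  have h1 : Tendsto (fun n : ℕ => (n : ℝ) ^ (2 / (d : ℝ)) * δ ^ 2) atTop atTop :=
    ((tendsto_rpow_atTop (by positivity)).comp tendsto_natCast_atTop_atTop).atTop_mul_const
      (by positivity)
  exact h1.eventually_ge_atTop s

lemma tendsto_measure_uncovered {d : ℕ} (hd : 0 < d) {δ : ℝ} (hδ : 0 < δ)
    {Z : (n : ℕ) → Fin n → Ω → M} (hZ_law : ∀ n i, HasLaw (Z n i) μ P)
    (hZ_indep : ∀ n, iIndepFun (Z n) P) {q : M × ℝ} (hq : 0 < q.2) {a : ℝ}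
    (ha : Tendsto (fun r : ℝ => μ.real (Metric.eball q.1 (ENNReal.ofReal r)) / r ^ d)
      (𝓝[>] 0) (𝓝 a)) :
    Tendsto (fun n => P {w | (w, q) ∈ uncovered (Z n) ((n : ℝ) ^ (2 / (d : ℝ))) δ}) atTop
      (𝓝 (ENNReal.ofReal (Real.exp (-(a * q.2 ^ ((d : ℝ) / 2)))))) := by
  refine (ENNReal.tendsto_ofReal (tendsto_one_sub_pow_exp_neg
    (tendsto_mul_measureReal_eball hd ha hq))).congr' ?_
  filter_upwards [eventually_le_rpow_mul_sq hd hδ q.2] with n hn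
  rw [measure_uncovered (hZ_law n) (hZ_indep n) ⟨hq, hn⟩]

lemma tendsto_measure_uncovered_inter {d : ℕ} (hd : 0 < d) {δ : ℝ} (hδ : 0 < δ)
    {Z : (n : ℕ) → Fin n → Ω → M} (hZ_law : ∀ n i, HasLaw (Z n i) μ P)
    (hZ_indep : ∀ n, iIndepFun (Z n) P) {q q' : M × ℝ} (hqq' : q.1 ≠ q'.1) (hq : 0 < q.2)
    (hq' : 0 < q'.2) {a a' : ℝ}
    (ha : Tendsto (fun r : ℝ => μ.real (Metric.eball q.1 (ENNReal.ofReal r)) / r ^ d)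
      (𝓝[>] 0) (𝓝 a))
    (ha' : Tendsto (fun r : ℝ => μ.real (Metric.eball q'.1 (ENNReal.ofReal r)) / r ^ d)
      (𝓝[>] 0) (𝓝 a')) :
    Tendsto (fun n => P {w | (w, q) ∈ uncovered (Z n) ((n : ℝ) ^ (2 / (d : ℝ))) δ ∧
        (w, q') ∈ uncovered (Z n) ((n : ℝ) ^ (2 / (d : ℝ))) δ}) atTop
      (𝓝 (ENNReal.ofReal (Real.exp (-(a * q.2 ^ ((d : ℝ) / 2)))) *
        ENNReal.ofReal (Real.exp (-(a' * q'.2 ^ ((d : ℝ) / 2)))))) := by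
  have h1 := (tendsto_mul_measureReal_eball hd ha hq).add
    (tendsto_mul_measureReal_eball hd ha' hq')
  simp only [← mul_add] at h1
  rw [← ENNReal.ofReal_mul (Real.exp_nonneg _), ← Real.exp_add, ← neg_add]
  refine (ENNReal.tendsto_ofReal (tendsto_one_sub_pow_exp_neg h1)).congr' ?_
  -- Both radii tend to zero, so the balls are eventually disjoint and their masses add. This is the
  -- asymptotic independence of the two points.
  have hsep : ∀ᶠ n : ℕ in atTop, ENNReal.ofReal √(q.2 / (n : ℝ) ^ (2 / (d : ℝ))) +
      ENNReal.ofReal √(q'.2 / (n : ℝ) ^ (2 / (d : ℝ))) ≤ edist q.1 q'.1 := by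
    have h2 := (ENNReal.tendsto_ofReal
      (tendsto_nhds_of_tendsto_nhdsWithin (tendsto_sqrt_div_rpow hd hq))).add
      (ENNReal.tendsto_ofReal
        (tendsto_nhds_of_tendsto_nhdsWithin (tendsto_sqrt_div_rpow hd hq')))
    rw [ENNReal.ofReal_zero, add_zero] at h2
    exact h2.eventually (eventually_le_nhds (edist_pos.2 hqq'))
  filter_upwards [eventually_le_rpow_mul_sq hd hδ q.2, eventually_le_rpow_mul_sq hd hδ q'.2,
    hsep] with n hn hn' hsep
  rw [measure_uncovered_inter (hZ_law n) (hZ_indep n) ⟨hq, hn⟩ ⟨hq', hn'⟩,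
    measureReal_union (Metric.eball_disjoint hsep) Metric.isOpen_eball.measurableSet]

end Coverage

lemma volume_setOf_pos_and_ofReal_le (a : ℝ≥0∞) :
    volume {s : ℝ | 0 < s ∧ ENNReal.ofReal s ≤ a} = a := by
  rcases eq_or_ne a ⊤ with rfl | ha
  · have : {s : ℝ | 0 < s ∧ ENNReal.ofReal s ≤ ⊤} = Ioi 0 := by ext s; simp
    rw [this, Real.volume_Ioi]
  · have : {s : ℝ | 0 < s ∧ ENNReal.ofReal s ≤ a} = Ioc 0 a.toReal := by
      ext s
      simp [ENNReal.ofReal_le_iff_le_toReal ha]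
    rw [this, Real.volume_Ioc, sub_zero, ENNReal.ofReal_toReal ha]

/-! ### Convergence of the rescaled nearest-neighbour error. -/

section NearestNeighbour

variable {M Ω : Type*} [EMetricSpace M] [MeasurableSpace M] {μ : Measure M}

lemma measurable_iInf_edist_sq [BorelSpace M] {n : ℕ} (Z : Fin n → M) :
    Measurable fun y => ⨅ i, edist y (Z i) ^ 2 :=
  Measurable.iInf fun _ => ((continuous_id.edist continuous_const).measurable).pow_const 2

lemma measure_singleton_eq_zero_of_tendsto [IsFiniteMeasure μ] {d : ℕ} (hd : 0 < d) {y : M} {a : ℝ}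
    (ha : Tendsto (fun r : ℝ => μ.real (Metric.eball y (ENNReal.ofReal r)) / r ^ d)
      (𝓝[>] 0) (𝓝 a)) : μ {y} = 0 := by
  have h1 : Tendsto (fun r : ℝ => r ^ d) (𝓝[>] 0) (𝓝 0) := by
    have := ((continuous_pow d).tendsto (0 : ℝ)).mono_left (nhdsWithin_le_nhds (s := Ioi 0))
    rwa [zero_pow hd.ne'] at this
  have h2 := ha.mul h1
  rw [mul_zero] at h2
  have h3 : μ.real {y} ≤ 0 := by
    refine ge_of_tendsto h2 ?_
    filter_upwards [self_mem_nhdsWithin] with r hr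
    have hr' : (0 : ℝ) < r := hr
    rw [div_mul_cancel₀ _ (by positivity)]
    exact measureReal_mono (singleton_subset_iff.2
      (Metric.mem_eball_self (ENNReal.ofReal_pos.2 hr')))
  exact (measureReal_eq_zero_iff).1 (le_antisymm h3 measureReal_nonneg)

variable [CompactSpace M] [BorelSpace M] [MeasurableSpace Ω] {P : Measure Ω}

/-- Layer-cake formula in the variable `s`: the fibre over `y` is an interval from 0 to `b` times
the squared distance from `y` to the nearest sample. Coverage at scale `δ` makes the truncation
harmless. -/
lemma measure_section_uncovered [SFinite μ] {n : ℕ} {Z : Fin n → Ω → M} (hZ : ∀ i, Measurable (Z i)) {b δ : ℝ}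
    (hb : 0 < b) (hδ : 0 < δ) {w : Ω} (hw : ∀ y, ∃ i, edist y (Z i w) ≤ ENNReal.ofReal δ) :
    (μ.prod (volume.restrict (Ioi (0 : ℝ)))) (Prod.mk w ⁻¹' uncovered Z b δ) =
      ENNReal.ofReal b * ∫⁻ y, ⨅ i, edist y (Z i w) ^ 2 ∂μ := by
  have hm : MeasurableSet (Prod.mk w ⁻¹' uncovered Z b δ) :=
    measurable_prodMk_left (measurableSet_uncovered hZ b δ)
  rw [Measure.prod_apply hm, ← lintegral_const_mul _ (measurable_iInf_edist_sq fun i => Z i w)]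
  refine lintegral_congr fun y => ?_
  have hset : Prod.mk y ⁻¹' (Prod.mk w ⁻¹' uncovered Z b δ) =
      {s : ℝ | 0 < s ∧ ENNReal.ofReal s ≤ ENNReal.ofReal b * ⨅ i, edist y (Z i w) ^ 2} := by
    ext s
    have hiff : ∀ s, 0 < s → ∀ i, (ENNReal.ofReal √(s / b) ≤ edist y (Z i w) ↔
        ENNReal.ofReal s ≤ ENNReal.ofReal b * edist y (Z i w) ^ 2) := by
      intro s hs i
      have hsb : s = b * √(s / b) ^ 2 := by
        rw [Real.sq_sqrt (by positivity)]; field_simp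
      have hb' : ENNReal.ofReal b ≠ 0 := (ENNReal.ofReal_pos.2 hb).ne'
      conv_rhs => rw [hsb, ENNReal.ofReal_mul hb.le, ENNReal.ofReal_pow (Real.sqrt_nonneg _),
        ENNReal.mul_le_mul_iff_right hb' ENNReal.ofReal_ne_top,
        ENNReal.pow_le_pow_left_iff two_ne_zero]
    simp only [uncovered, mem_preimage, mem_ofPred_eq]
    constructor
    · rintro ⟨⟨h0, h1⟩, h2⟩
      refine ⟨h0, ?_⟩
      rw [ENNReal.mul_iInf_of_ne (ENNReal.ofReal_pos.2 hb).ne' ENNReal.ofReal_ne_top]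
      exact le_iInf fun i => (hiff s h0 i).1 (h2 i)
    · rintro ⟨h0, h1⟩
      have h2 : ∀ i, ENNReal.ofReal s ≤ ENNReal.ofReal b * edist y (Z i w) ^ 2 := fun i =>
        h1.trans (by gcongr; exact iInf_le _ i)
      refine ⟨⟨h0, ?_⟩, fun i => (hiff s h0 i).2 (h2 i)⟩
      obtain ⟨i, hi⟩ := hw y
      have h3 : ENNReal.ofReal s ≤ ENNReal.ofReal (b * δ ^ 2) := by
        rw [ENNReal.ofReal_mul hb.le, ENNReal.ofReal_pow hδ.le]
        exact (h2 i).trans (by gcongr)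
      exact (ENNReal.ofReal_le_ofReal_iff (by positivity)).1 h3
  have hms : MeasurableSet (Prod.mk y ⁻¹' (Prod.mk w ⁻¹' uncovered Z b δ)) :=
    measurable_prodMk_left hm
  rw [Measure.restrict_apply hms, inter_eq_left.2, hset, volume_setOf_pos_and_ofReal_le]
  rw [hset]
  exact fun s hs => hs.1

variable [IsProbabilityMeasure μ]

/-- With high probability, every point is close to a sample. -/
lemma tendsto_measure_not_covered
    (hpos : ∀ (y : M) (r : ℝ), 0 < r → 0 < μ.real (Metric.eball y (ENNReal.ofReal r)))
    {Z : (n : ℕ) → Fin n → Ω → M} (hZ_law : ∀ n i, HasLaw (Z n i) μ P)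
    (hZ_indep : ∀ n, iIndepFun (Z n) P) {δ : ℝ} (hδ : 0 < δ) :
    Tendsto (fun n => P {w | ¬ ∀ y, ∃ i, edist y (Z n i w) ≤ ENNReal.ofReal δ}) atTop (𝓝 0) := by
  have hδ2 : 0 < ENNReal.ofReal (δ / 2) := ENNReal.ofReal_pos.2 (by positivity)
  -- If some `y` is farther than `δ` from all samples, the ball of radius `δ / 2` of the finite
  -- cover that contains `y` has no sample; a union bound over the cover concludes.
  obtain ⟨t, ht⟩ := CompactSpace.elim_nhds_subcover
    (fun y : M => Metric.eball y (ENNReal.ofReal (δ / 2)))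
    (fun y => Metric.eball_mem_nhds y hδ2)
  have hlim : Tendsto (fun n => ∑ x ∈ t,
      P {w | ∀ i, Z n i w ∉ Metric.eball x (ENNReal.ofReal (δ / 2))}) atTop (𝓝 0) := by
    suffices h : Tendsto (fun n => ∑ x ∈ t,
        P {w | ∀ i, Z n i w ∉ Metric.eball x (ENNReal.ofReal (δ / 2))}) atTop
        (𝓝 (∑ _x ∈ t, (0 : ℝ≥0∞))) by rwa [Finset.sum_const_zero] at h
    refine tendsto_finsetSum _ fun x _ => ?_
    have h1 : Tendsto (fun n : ℕ =>
        (1 - μ.real (Metric.eball x (ENNReal.ofReal (δ / 2)))) ^ n) atTop (𝓝 0) := by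
      refine tendsto_pow_atTop_nhds_zero_of_lt_one ?_ ?_
      · linarith [measureReal_le_one (μ := μ) (s := Metric.eball x (ENNReal.ofReal (δ / 2)))]
      · linarith [hpos x (δ / 2) (by positivity)]
    have h2 := ENNReal.tendsto_ofReal h1
    rw [ENNReal.ofReal_zero] at h2
    refine h2.congr fun n => ?_
    rw [measure_forall_notMem (hZ_law n) (hZ_indep n) Metric.isOpen_eball.measurableSet]
  refine tendsto_of_tendsto_of_tendsto_of_le_of_le tendsto_const_nhds hlim
    (fun n => zero_le) fun n => ?_
  refine le_trans (measure_mono ?_) (measure_biUnion_finset_le t _)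
  intro w hw
  simp only [mem_ofPred_eq, not_forall, not_exists, not_le] at hw
  obtain ⟨y, hy⟩ := hw
  have hyt : y ∈ ⋃ x ∈ t, Metric.eball x (ENNReal.ofReal (δ / 2)) := by rw [ht]; trivial
  simp only [mem_iUnion, exists_prop, Metric.mem_eball] at hyt
  obtain ⟨x, hx, hyx⟩ := hyt
  simp only [mem_iUnion, exists_prop, mem_ofPred_eq]
  refine ⟨x, hx, fun i hi => (hy i).not_ge ?_⟩
  rw [Metric.mem_eball] at hi
  calc edist y (Z n i w) ≤ edist y x + edist (Z n i w) x := edist_triangle_right _ _ _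
    _ ≤ ENNReal.ofReal (δ / 2) + ENNReal.ofReal (δ / 2) := add_le_add hyx.le hi.le
    _ = ENNReal.ofReal δ := by
      rw [← ENNReal.ofReal_add (by positivity) (by positivity), add_halves]

/-- Pairs over the same point, whose balls are never disjoint, are negligible because `μ` has no
atoms. -/
lemma ae_prod_fst_ne {ν : Measure ℝ} [SFinite ν] (hμ : ∀ y, μ {y} = 0) :
    ∀ᵐ z ∂((μ.prod ν).prod (μ.prod ν)), z.1.1 ≠ z.2.1 := by
  have hm : MeasurableSet {z : (M × ℝ) × (M × ℝ) | z.1.1 = z.2.1} :=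
    measurableSet_eq_fun (by fun_prop) (by fun_prop)
  rw [ae_iff]
  simp only [not_not]
  rw [Measure.measure_prod_null hm]
  refine Eventually.of_forall fun q => ?_
  have : Prod.mk q ⁻¹' {z : (M × ℝ) × (M × ℝ) | z.1.1 = z.2.1} = {q.1} ×ˢ univ := by
    ext q'; simp [eq_comm]
  change (μ.prod ν) (Prod.mk q ⁻¹' {z : (M × ℝ) × (M × ℝ) | z.1.1 = z.2.1}) = 0
  rw [this, Measure.prod_prod, hμ, zero_mul]

lemma integrableOn_exp_neg_mul_rpow {p b : ℝ} (hp : 0 < p) (hb : 0 < b) :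
    IntegrableOn (fun s : ℝ => Real.exp (-(b * s ^ p))) (Ioi 0) := by
  -- The integral of a non-integrable function is zero by convention, so a nonzero value proves
  -- integrability.
  refine Integrable.of_integral_ne_zero ?_
  simp only [← neg_mul]
  rw [integral_exp_neg_mul_rpow hp hb]
  have := Real.Gamma_pos_of_pos (show 0 < 1 / p + 1 by positivity)
  positivity

/-- The squared distance to the nearest of `n` samples, scaled by `n ^ (2 / d)`, has a mean that
converges in probability. -/
theorem tendsto_measure_nearest_sample {d : ℕ} (hd : 0 < d) {f : M → ℝ} (hf : Measurable f)
    (hlim : ∀ y, Tendsto (fun r : ℝ => μ.real (Metric.eball y (ENNReal.ofReal r)) / r ^ d)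
      (𝓝[>] 0) (𝓝 (f y)))
    {c δ : ℝ} (hc : 0 < c) (hδ : 0 < δ) (hlow : ∀ (y : M) (r : ℝ), 0 < r → r ≤ δ →
      c * r ^ d ≤ μ.real (Metric.eball y (ENNReal.ofReal r)))
    [IsProbabilityMeasure P] {Z : (n : ℕ) → Fin n → Ω → M} (hZ_meas : ∀ n i, Measurable (Z n i))
    (hZ_law : ∀ n i, HasLaw (Z n i) μ P) (hZ_indep : ∀ n, iIndepFun (Z n) P)
    {ε : ℝ} (hε : 0 < ε) :
    Tendsto (fun n : ℕ => P {w | ENNReal.ofReal ((n : ℝ) ^ (2 / (d : ℝ))) *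
        ∫⁻ y, ⨅ i, edist y (Z n i w) ^ 2 ∂μ = ⊤ ∨
      ε ≤ |(ENNReal.ofReal ((n : ℝ) ^ (2 / (d : ℝ))) *
        ∫⁻ y, ⨅ i, edist y (Z n i w) ^ 2 ∂μ).toReal -
        (∫⁻ q, ENNReal.ofReal (Real.exp (-(f q.1 * q.2 ^ ((d : ℝ) / 2))))
          ∂(μ.prod (volume.restrict (Ioi (0 : ℝ))))).toReal|}) atTop (𝓝 0) := by
  have hd' : (0 : ℝ) < d := by exact_mod_cast hd
  set ν := μ.prod (volume.restrict (Ioi (0 : ℝ))) with hν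
  set G : M × ℝ → ℝ≥0∞ := fun q => ENNReal.ofReal (Real.exp (-(c / 2 * q.2 ^ ((d : ℝ) / 2))))
    with hGdef
  have hG : Measurable G := by fun_prop
  have hae : ∀ᵐ q ∂ν, 0 < q.2 := by
    have h := (Measure.quasiMeasurePreserving_snd (μ := μ)
      (ν := volume.restrict (Ioi (0 : ℝ)))).ae (ae_restrict_mem measurableSet_Ioi)
    exact h
  have hG_fin : ∫⁻ q, G q ∂ν ≠ ⊤ := by
    rw [hν, lintegral_prod _ hG.aemeasurable]
    simp only [hGdef, lintegral_const, measure_univ, mul_one]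
    have := (integrableOn_exp_neg_mul_rpow (p := (d : ℝ) / 2) (b := c / 2) (by positivity)
      (by positivity)).lintegral_lt_top
    exact this.ne
  have hG1 : ∀ᵐ q ∂ν, G q ≤ 1 := by
    filter_upwards [hae] with q hq
    rw [← ENNReal.ofReal_one]
    refine ENNReal.ofReal_le_ofReal (Real.exp_le_one_iff.2 ?_)
    have : 0 ≤ q.2 ^ ((d : ℝ) / 2) := by positivity
    have : 0 ≤ c / 2 * q.2 ^ ((d : ℝ) / 2) := by positivity
    linarith
  have hdom := fun n => measure_uncovered_inter_le (P := P) hd hδ hlow (hZ_law n) (hZ_indep n)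
  have key := tendsto_measure_le_abs_sub_measure_section (P := P) (ν := ν)
    (E := fun n => uncovered (Z n) ((n : ℝ) ^ (2 / (d : ℝ))) δ)
    (fun n => measurableSet_uncovered (hZ_meas n) _ _)
    (g := fun q => ENNReal.ofReal (Real.exp (-(f q.1 * q.2 ^ ((d : ℝ) / 2))))) (G := G)
    (by fun_prop) hG hG_fin ?_ ?_ hdom ?_ hε
  rotate_left
  · intro n
    filter_upwards [hG1] with q hq
    -- On the diagonal the two-point bound is `G q * G q`, which is at most `G q` since `G q ≤ 1`.
    have h := hdom n q q
    simp only [and_self] at h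
    exact h.trans (mul_le_of_le_one_right' hq)
  · filter_upwards [hae] with q hq
    exact tendsto_measure_uncovered hd hδ hZ_law hZ_indep hq (hlim q.1)
  · have hae1 : ∀ᵐ z ∂(ν.prod ν), 0 < z.1.2 := Measure.quasiMeasurePreserving_fst.ae hae
    have hae2 : ∀ᵐ z ∂(ν.prod ν), 0 < z.2.2 := Measure.quasiMeasurePreserving_snd.ae hae
    filter_upwards [hae1, hae2, ae_prod_fst_ne (μ := μ) (ν := volume.restrict (Ioi (0 : ℝ)))
      fun y => measure_singleton_eq_zero_of_tendsto hd (hlim y)] with z h1 h2 h3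
    exact tendsto_measure_uncovered_inter hd hδ hZ_law hZ_indep h3 h1 h2 (hlim _) (hlim _)
  have hpos : ∀ (y : M) (r : ℝ), 0 < r → 0 < μ.real (Metric.eball y (ENNReal.ofReal r)) := by
    intro y r hr
    have h1 : 0 < min r δ := lt_min hr hδ
    refine lt_of_lt_of_le (by positivity) ((hlow y _ h1 (min_le_right _ _)).trans
      (measureReal_mono (Metric.eball_subset_eball (ENNReal.ofReal_le_ofReal (min_le_left _ _)))))
  have hcov := tendsto_measure_not_covered hpos hZ_law hZ_indep hδ
  -- The bad event lies in the union of a failure of coverage and a deviation of the measure of the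
  -- section; under coverage the error is finite, which excludes the value `⊤`.
  have hsum := hcov.add key
  rw [add_zero] at hsum
  refine tendsto_of_tendsto_of_tendsto_of_le_of_le' tendsto_const_nhds hsum
    (Eventually.of_forall fun n => zero_le) ?_
  filter_upwards [eventually_gt_atTop 0] with n hn
  have hn' : (0 : ℝ) < n := by exact_mod_cast hn
  refine le_trans (measure_mono ?_) (measure_union_le _ _)
  intro w hw
  by_cases hcw : ∀ y, ∃ i, edist y (Z n i w) ≤ ENNReal.ofReal δ
  swap
  · exact Or.inl hcw
  refine Or.inr ?_
  have hS := measure_section_uncovered (μ := μ) (hZ_meas n) (b := (n : ℝ) ^ (2 / (d : ℝ)))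
    (by positivity) hδ hcw
  have hfin : ENNReal.ofReal ((n : ℝ) ^ (2 / (d : ℝ))) *
      ∫⁻ y, ⨅ i, edist y (Z n i w) ^ 2 ∂μ ≠ ⊤ := by
    refine ENNReal.mul_ne_top ENNReal.ofReal_ne_top ?_
    refine ne_top_of_le_ne_top (b := ∫⁻ y, ENNReal.ofReal δ ^ 2 ∂μ) ?_ (lintegral_mono fun y => ?_)
    · simp
    · obtain ⟨i, hi⟩ := hcw y
      exact (iInf_le _ i).trans (by gcongr)
  change ε ≤ |(ν (Prod.mk w ⁻¹' uncovered (Z n) ((n : ℝ) ^ (2 / (d : ℝ))) δ)).toReal - _|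
  rw [hν, hS]
  exact hw.resolve_left hfin

end NearestNeighbour
lemma exists_one_lt_pow_eq {K : ℝ} (hK : 1 < K) {n : ℕ} (hn : n ≠ 0) : ∃ k > 1, k ^ n = K := by
  have hn' : (0 : ℝ) < n := by exact_mod_cast Nat.pos_of_ne_zero hn
  exact ⟨K ^ ((n : ℝ)⁻¹), Real.one_lt_rpow hK (by positivity),
    Real.rpow_inv_natCast_pow (by linarith) hn⟩

section Continuous

variable {B F : Type*} [NormedAddCommGroup F] [NormedSpace ℝ F]
  {EB HB : Type*} [NormedAddCommGroup EB] [NormedSpace ℝ EB] [TopologicalSpace HB]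
  {IB : ModelWithCorners ℝ EB HB} {n : WithTop ℕ∞} [TopologicalSpace B] [ChartedSpace HB B]
  {E : B → Type*} [TopologicalSpace (TotalSpace F E)] [∀ x, NormedAddCommGroup (E x)]
  [∀ x, InnerProductSpace ℝ (E x)] [FiberBundle F E] [VectorBundle ℝ F E]

lemma isContinuousRiemannianBundle_of_isContMDiffRiemannianBundle
    [h : IsContMDiffRiemannianBundle IB n F E] : IsContinuousRiemannianBundle F E := by
  obtain ⟨g, g_smooth, hg⟩ := h.exists_contMDiff
  exact ⟨⟨g, g_smooth.continuous, hg⟩⟩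

end Continuous

/-! ### Mass of small balls under the law of the samples. -/

section Density

variable {d : ℕ} {M : Type*} [EMetricSpace M] [ChartedSpace (EuclideanSpace ℝ (Fin d)) M]
  [RiemannianBundle (fun x : M => TangentSpace (𝓡 d) x)] [IsManifold (𝓡 d) 1 M]
  [IsContinuousRiemannianBundle (EuclideanSpace ℝ (Fin d)) (fun x : M => TangentSpace (𝓡 d) x)]
  [IsRiemannianManifold (𝓡 d) M] [MeasurableSpace M] [BorelSpace M]

/-- The density of the law `p`, with respect to the Euclidean volume of small balls. -/
lemma tendsto_withDensity_eball_div_pow [IsFiniteMeasure (riemannianVolume d M)]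
    {p : M → ℝ} (hp : Continuous p) (hp_pos : ∀ y, 0 < p y) (y : M) :
    Tendsto (fun r : ℝ => ((riemannianVolume d M).withDensity fun z => ENNReal.ofReal (p z)).real
        (Metric.eball y (ENNReal.ofReal r)) / r ^ d) (𝓝[>] 0)
      (𝓝 (volume.real (Metric.ball (0 : EuclideanSpace ℝ (Fin d)) 1) * p y)) := by
  set β := volume.real (Metric.ball (0 : EuclideanSpace ℝ (Fin d)) 1) with hβ
  have hpy := hp_pos y
  -- The absolute value makes `u` nonnegative for every `r`, as `tendsto_of_forall_one_lt_mul`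
  -- requires; it is immaterial for `r > 0`.
  set u : ℝ → ℝ := fun r => ((riemannianVolume d M).withDensity fun z => ENNReal.ofReal (p z)).real
        (Metric.eball y (ENNReal.ofReal r)) / |r| ^ d with hu
  have hu' : Tendsto u (𝓝[>] 0) (𝓝 (β * p y)) := by
    refine tendsto_of_forall_one_lt_mul (by positivity) (fun r => by positivity) fun K hK => ?_
    -- The volume of the ball costs `k ^ (d + 1)` and the variation of `p` on it costs one more `k`.
    obtain ⟨k, hk, rfl⟩ := exists_one_lt_pow_eq hK (n := d + 2) (by omega)
    have hk0 : 0 < k := by linarith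
    obtain ⟨r₀, hr₀, hev⟩ := eventually_riemannianVolume_eball (d := d) y hk
    have hvol := hev.self_of_nhds
    have hpk : ∀ᶠ z in 𝓝 y, p z ≤ k * p y ∧ p y ≤ k * p z :=
      ((hp.tendsto y).eventually (eventually_le_nhds (by nlinarith))).and
        (((hp.tendsto y).const_mul k).eventually (eventually_ge_nhds (by nlinarith)))
    obtain ⟨ρ, hρ, hρp⟩ := EMetric.mem_nhds_iff.1 hpk
    have hρ' : ∀ᶠ r : ℝ in 𝓝[>] 0, ENNReal.ofReal r ≤ ρ := by
      have h1 : Tendsto ENNReal.ofReal (𝓝[>] (0 : ℝ)) (𝓝 (ENNReal.ofReal 0)) :=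
        (ENNReal.continuous_ofReal.tendsto 0).mono_left nhdsWithin_le_nhds
      rw [ENNReal.ofReal_zero] at h1
      exact h1.eventually (eventually_le_nhds hρ)
    filter_upwards [hρ', Ioc_mem_nhdsGT hr₀] with r hrρ hr
    have hr0 : 0 < r := hr.1
    set A := Metric.eball y (ENNReal.ofReal r) with hA
    have hAm : MeasurableSet A := Metric.isOpen_eball.measurableSet
    have hAp : ∀ z ∈ A, p z ≤ k * p y ∧ p y ≤ k * p z := fun z hz =>
      hρp (Metric.eball_subset_eball hrρ hz)
    obtain ⟨hv1, hv2⟩ := hvol r hr.1 hr.2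
    have hβt : volume (Metric.ball (0 : EuclideanSpace ℝ (Fin d)) 1) = ENNReal.ofReal β :=
      (ofReal_measureReal measure_ball_lt_top.ne).symm
    have hvA : riemannianVolume d M A = ENNReal.ofReal ((riemannianVolume d M).real A) :=
      (ofReal_measureReal (measure_ne_top _ _)).symm
    rw [← hA, hvA, hβt, ← ENNReal.ofReal_mul (by positivity),
      ENNReal.ofReal_le_ofReal_iff (by positivity)] at hv1
    rw [← hA, hvA, hβt, ← ENNReal.ofReal_mul (by positivity), ← ENNReal.ofReal_mul (by positivity),
      ENNReal.ofReal_le_ofReal_iff (by positivity)] at hv2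
    set V := (riemannianVolume d M).real A with hV
    set μ := (riemannianVolume d M).withDensity fun z => ENNReal.ofReal (p z) with hμ
    have hm1 : μ A ≤ ENNReal.ofReal (k * p y * V) := by
      rw [hμ, withDensity_apply _ hAm, ENNReal.ofReal_mul (by positivity), ← hvA,
        ← setLIntegral_const]
      exact setLIntegral_mono' hAm fun z hz => ENNReal.ofReal_le_ofReal (hAp z hz).1
    have hm2 : ENNReal.ofReal (p y * V) ≤ ENNReal.ofReal k * μ A := by
      rw [hμ, withDensity_apply _ hAm, ENNReal.ofReal_mul hpy.le, ← hvA,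
        ← setLIntegral_const, ← lintegral_const_mul' _ _ ENNReal.ofReal_ne_top]
      refine setLIntegral_mono' hAm fun z hz => ?_
      rw [← ENNReal.ofReal_mul hk0.le]
      exact ENNReal.ofReal_le_ofReal (hAp z hz).2
    have hfin : μ A ≠ ⊤ := ne_top_of_le_ne_top ENNReal.ofReal_ne_top hm1
    have hμA : μ A = ENNReal.ofReal (μ.real A) := (ofReal_measureReal hfin).symm
    rw [hμA, ENNReal.ofReal_le_ofReal_iff (by positivity)] at hm1
    rw [hμA, ← ENNReal.ofReal_mul hk0.le, ENNReal.ofReal_le_ofReal_iff (by positivity)] at hm2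
    simp only [hu, abs_of_pos hr0]
    constructor
    · rw [div_le_iff₀ (by positivity)]
      calc μ.real A ≤ k * p y * V := hm1
        _ ≤ k * p y * (k ^ (d + 1) * r ^ d * β) := by gcongr
        _ = _ := by ring
    · rw [mul_div_assoc', le_div_iff₀ (by positivity)]
      calc β * p y * r ^ d = p y * (r ^ d * β) := by ring
        _ ≤ p y * (k ^ (d + 1) * V) := by gcongr
        _ = k ^ (d + 1) * (p y * V) := by ring
        _ ≤ k ^ (d + 1) * (k * μ.real A) := by gcongr
        _ = _ := by ring
  refine hu'.congr' ?_
  filter_upwards [self_mem_nhdsWithin] with r hr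
  have hr' : (0 : ℝ) < r := hr
  simp only [hu, abs_of_pos hr']

/-- Small balls have a volume at least proportional to the one of Euclidean balls, uniformly. -/
lemma exists_mul_pow_le_withDensity_eball [CompactSpace M] [Nonempty M]
    [IsFiniteMeasure (riemannianVolume d M)] {p : M → ℝ} (hp : Continuous p)
    (hp_pos : ∀ y, 0 < p y) :
    ∃ c > 0, ∃ δ > 0, ∀ (y : M) (r : ℝ), 0 < r → r ≤ δ →
      c * r ^ d ≤ ((riemannianVolume d M).withDensity fun z => ENNReal.ofReal (p z)).real
        (Metric.eball y (ENNReal.ofReal r)) := by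
  obtain ⟨y₀, -, hy₀⟩ := isCompact_univ.exists_isMinOn univ_nonempty hp.continuousOn
  obtain ⟨y₁, -, hy₁⟩ := isCompact_univ.exists_isMaxOn univ_nonempty hp.continuousOn
  set β := volume.real (Metric.ball (0 : EuclideanSpace ℝ (Fin d)) 1) with hβ
  have hβt : volume (Metric.ball (0 : EuclideanSpace ℝ (Fin d)) 1) = ENNReal.ofReal β :=
    (ofReal_measureReal measure_ball_lt_top.ne).symm
  have hβ0 : 0 < β := ENNReal.toReal_pos (Metric.measure_ball_pos _ _ one_pos).ne'
    measure_ball_lt_top.ne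
  have hunif : ∃ δ > 0, ∀ y ∈ (univ : Set M), ∀ r, 0 < r → r ≤ δ →
      ENNReal.ofReal (r ^ d) * volume (Metric.ball (0 : EuclideanSpace ℝ (Fin d)) 1) ≤
        ENNReal.ofReal (2 ^ (d + 1)) *
          riemannianVolume d M (Metric.eball y (ENNReal.ofReal r)) := by
    -- The local estimate at each point, with distortion 2, holds on a neighbourhood with one radius
    -- bound; compactness makes that bound uniform.
    refine isCompact_univ.induction_on (p := fun s => ∃ δ > 0, ∀ y ∈ s, ∀ r, 0 < r → r ≤ δ →
      ENNReal.ofReal (r ^ d) * volume (Metric.ball (0 : EuclideanSpace ℝ (Fin d)) 1) ≤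
        ENNReal.ofReal (2 ^ (d + 1)) *
          riemannianVolume d M (Metric.eball y (ENNReal.ofReal r))) ?_ ?_ ?_ ?_
    · exact ⟨1, one_pos, fun y hy => hy.elim⟩
    · rintro s t hst ⟨δ, hδ, h⟩
      exact ⟨δ, hδ, fun y hy => h y (hst hy)⟩
    · rintro s t ⟨δ, hδ, h⟩ ⟨δ', hδ', h'⟩
      refine ⟨min δ δ', lt_min hδ hδ', ?_⟩
      rintro y (hy | hy) r hr hrδ
      · exact h y hy r hr (hrδ.trans (min_le_left _ _))
      · exact h' y hy r hr (hrδ.trans (min_le_right _ _))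
    · intro x _
      obtain ⟨r₀, hr₀, hev⟩ := eventually_riemannianVolume_eball (d := d) x one_lt_two
      exact ⟨_, mem_nhdsWithin_of_mem_nhds hev, r₀, hr₀, fun y hy r hr hr' => (hy r hr hr').2⟩
  obtain ⟨δ, hδ, h⟩ := hunif
  have hpy := hp_pos y₀
  refine ⟨p y₀ * β / 2 ^ (d + 1), by positivity, δ, hδ, fun y r hr hrδ => ?_⟩
  have hv := h y trivial r hr hrδ
  set A := Metric.eball y (ENNReal.ofReal r) with hA
  have hAm : MeasurableSet A := Metric.isOpen_eball.measurableSet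
  set μ := (riemannianVolume d M).withDensity fun z => ENNReal.ofReal (p z) with hμ
  have hvA : riemannianVolume d M A = ENNReal.ofReal ((riemannianVolume d M).real A) :=
      (ofReal_measureReal (measure_ne_top _ _)).symm
  rw [hvA, hβt, ← ENNReal.ofReal_mul (by positivity), ← ENNReal.ofReal_mul (by positivity),
    ENNReal.ofReal_le_ofReal_iff (by positivity)] at hv
  have hfin : μ A ≠ ⊤ := by
    rw [hμ, withDensity_apply _ hAm]
    refine ne_top_of_le_ne_top (b := ∫⁻ z in A, ENNReal.ofReal (p y₁) ∂(riemannianVolume d M)) ?_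
      (lintegral_mono fun z => ENNReal.ofReal_le_ofReal (hy₁ (mem_univ z)))
    rw [setLIntegral_const]
    exact ENNReal.mul_ne_top ENNReal.ofReal_ne_top (measure_ne_top _ _)
  have hm : ENNReal.ofReal (p y₀ * (riemannianVolume d M).real A) ≤ μ A := by
    rw [hμ, withDensity_apply _ hAm, ENNReal.ofReal_mul hpy.le, ← hvA, ← setLIntegral_const]
    exact lintegral_mono fun z => ENNReal.ofReal_le_ofReal (hy₀ (mem_univ z))
  rw [← ofReal_measureReal hfin, ENNReal.ofReal_le_ofReal_iff (by positivity)] at hm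
  refine le_trans ?_ hm
  rw [div_mul_eq_mul_div, div_le_iff₀ (by positivity)]
  calc p y₀ * β * r ^ d = p y₀ * (r ^ d * β) := by ring
    _ ≤ p y₀ * (2 ^ (d + 1) * (riemannianVolume d M).real A) := by gcongr
    _ = _ := by ring

end Density

/-! ### Computation of the limiting constant. -/

section Constant

lemma volumeReal_unit_ball {d : ℕ} (hd : 0 < d) :
    volume.real (Metric.ball (0 : EuclideanSpace ℝ (Fin d)) 1) =
      √Real.pi ^ d / Real.Gamma (d / 2 + 1) := by
  have : Nonempty (Fin d) := ⟨⟨0, hd⟩⟩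
  have hG : 0 < Real.Gamma ((d : ℝ) / 2 + 1) := Real.Gamma_pos_of_pos (by positivity)
  rw [Measure.real, EuclideanSpace.volume_ball, Fintype.card_fin, ENNReal.ofReal_one, one_pow,
    one_mul, ENNReal.toReal_ofReal (by positivity)]

/-- With κ = π^(d/2) / Γ(1 + d/2), the power κ^(−2/d) is Γ(1 + d/2)^(2/d) / π. -/
lemma unit_ball_rpow_mul_Gamma {d : ℕ} (hd : 0 < d) :
    volume.real (Metric.ball (0 : EuclideanSpace ℝ (Fin d)) 1) ^ (-1 / ((d : ℝ) / 2)) *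
      Real.Gamma (1 / ((d : ℝ) / 2) + 1) = constJ d := by
  have hd' : (0 : ℝ) < d := by exact_mod_cast hd
  have hG : 0 < Real.Gamma ((d : ℝ) / 2 + 1) := Real.Gamma_pos_of_pos (by positivity)
  have hpi := Real.pi_pos
  have e1 : 1 / ((d : ℝ) / 2) = 2 / d := by field_simp
  have e2 : -1 / ((d : ℝ) / 2) = -(2 / d) := by field_simp
  have h1 : (√Real.pi ^ d) ^ (-(2 / (d : ℝ))) = 1 / Real.pi := by
    rw [Real.sqrt_eq_rpow, ← Real.rpow_natCast, ← Real.rpow_mul hpi.le, ← Real.rpow_mul hpi.le]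
    have : 1 / 2 * (d : ℝ) * -(2 / d) = -1 := by field_simp
    rw [this, Real.rpow_neg_one, one_div]
  rw [volumeReal_unit_ball hd, e1, e2, Real.div_rpow (by positivity) hG.le, h1,
    Real.rpow_neg hG.le, div_inv_eq_mul, constJ, add_comm (1 : ℝ) (d / 2), add_comm (1 : ℝ) (2 / d)]

lemma constJ_pos {d : ℕ} (hd : 0 < d) : 0 < constJ d := by
  have hd' : (0 : ℝ) < d := by exact_mod_cast hd
  have h1 : 0 < Real.Gamma (1 + (d : ℝ) / 2) := Real.Gamma_pos_of_pos (by positivity)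
  have h2 : 0 < Real.Gamma (1 + 2 / (d : ℝ)) := Real.Gamma_pos_of_pos (by positivity)
  have := Real.pi_pos
  unfold constJ
  positivity

lemma lintegral_exp_neg_mul_rpow {p b : ℝ} (hp : 0 < p) (hb : 0 < b) :
    ∫⁻ s in Ioi (0 : ℝ), ENNReal.ofReal (Real.exp (-(b * s ^ p))) =
      ENNReal.ofReal (b ^ (-1 / p) * Real.Gamma (1 / p + 1)) := by
  rw [← ofReal_integral_eq_lintegral_ofReal (integrableOn_exp_neg_mul_rpow hp hb)
    (Eventually.of_forall fun s => Real.exp_nonneg _), ← integral_exp_neg_mul_rpow hp hb]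
  simp only [neg_mul]

/-- The inner integral is (κ p(y))^(−2/d) Γ(1 + 2/d); the weight p(y) of the law turns p^(−2/d) into
p^((d−2)/d). -/
lemma toReal_lintegral_exp_neg_eq {M : Type*} [MeasurableSpace M] {vol : Measure M}
    [IsFiniteMeasure vol] {d : ℕ} (hd : 0 < d) {p : M → ℝ} (hp : Measurable p)
    (hp_pos : ∀ y, 0 < p y) :
    (∫⁻ q, ENNReal.ofReal (Real.exp (-(volume.real (Metric.ball (0 : EuclideanSpace ℝ (Fin d)) 1) *
        p q.1 * q.2 ^ ((d : ℝ) / 2)))) ∂((vol.withDensity fun y => ENNReal.ofReal (p y)).prod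
          (volume.restrict (Ioi (0 : ℝ))))).toReal =
      constJ d * volumeFunctional vol d p := by
  have hd' : (0 : ℝ) < d := by exact_mod_cast hd
  have hκ : 0 < volume.real (Metric.ball (0 : EuclideanSpace ℝ (Fin d)) 1) :=
    ENNReal.toReal_pos (Metric.measure_ball_pos _ _ one_pos).ne' measure_ball_lt_top.ne
  have hJ := unit_ball_rpow_mul_Gamma hd
  set κ := volume.real (Metric.ball (0 : EuclideanSpace ℝ (Fin d)) 1)
  have hinner : ∀ y, ∫⁻ s in Ioi (0 : ℝ),
      ENNReal.ofReal (Real.exp (-(κ * p y * s ^ ((d : ℝ) / 2)))) =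
      ENNReal.ofReal ((κ * p y) ^ (-1 / ((d : ℝ) / 2)) * Real.Gamma (1 / ((d : ℝ) / 2) + 1)) :=
    fun y => lintegral_exp_neg_mul_rpow (by positivity) (mul_pos hκ (hp_pos y))
  rw [lintegral_prod _ (by fun_prop)]
  simp only [hinner]
  rw [lintegral_withDensity_eq_lintegral_mul _ (by fun_prop) (by fun_prop), volumeFunctional,
    ← integral_const_mul, integral_eq_lintegral_of_nonneg_ae]
  · congr 1
    refine lintegral_congr fun y => ?_
    have hy := hp_pos y
    rw [Pi.mul_apply, ← ENNReal.ofReal_mul hy.le, ← hJ, Real.mul_rpow hκ.le hy.le]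
    have h1 : p y ^ (((d : ℝ) - 2) / d) = p y * p y ^ (-1 / ((d : ℝ) / 2)) := by
      have h2 : ((d : ℝ) - 2) / d = 1 + -1 / ((d : ℝ) / 2) := by
        field_simp
        ring
      rw [h2, Real.rpow_add hy, Real.rpow_one]
    rw [h1]
    congr 1
    ring
  · refine Eventually.of_forall fun y => ?_
    have := (constJ_pos hd).le
    have := (hp_pos y).le
    change 0 ≤ constJ d * p y ^ (((d : ℝ) - 2) / d)
    positivity
  · exact ((hp.pow_const _).const_mul _).aestronglyMeasurable

end Constant

/-! ### Consequences of compactness and of total mass one. -/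

section Compact

variable {M : Type*} [MeasurableSpace M] {vol : Measure M} {p : M → ℝ}

lemma nonempty_of_integral_eq_one (hp_int : ∫ y, p y ∂vol = 1) : Nonempty M := by
  by_contra h
  rw [not_nonempty_iff] at h
  rw [integral_of_isEmpty] at hp_int
  exact zero_ne_one hp_int

lemma isProbabilityMeasure_withDensity_of_integral_eq_one (hp_pos : ∀ y, 0 < p y)
    (hp_int : ∫ y, p y ∂vol = 1) :
    IsProbabilityMeasure (vol.withDensity fun y => ENNReal.ofReal (p y)) := by
  refine ⟨?_⟩
  have hi : Integrable p vol := Integrable.of_integral_ne_zero (by rw [hp_int]; exact one_ne_zero)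
  rw [withDensity_apply _ MeasurableSet.univ, Measure.restrict_univ,
    ← ofReal_integral_eq_lintegral_ofReal hi (Eventually.of_forall fun y => (hp_pos y).le),
    hp_int, ENNReal.ofReal_one]

variable [TopologicalSpace M] [CompactSpace M]

/-- By compactness `p` is bounded below by a positive constant, which is integrable because `p` is.
-/
lemma isFiniteMeasure_of_integral_eq_one (hp : Continuous p) (hp_pos : ∀ y, 0 < p y)
    (hp_int : ∫ y, p y ∂vol = 1) : IsFiniteMeasure vol := by
  have := nonempty_of_integral_eq_one hp_int
  have hi : Integrable p vol := Integrable.of_integral_ne_zero (by rw [hp_int]; exact one_ne_zero)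
  obtain ⟨y₀, -, hy₀⟩ := isCompact_univ.exists_isMinOn univ_nonempty hp.continuousOn
  have hc : Integrable (fun _ : M => p y₀) vol := by
    refine hi.mono' aestronglyMeasurable_const (Eventually.of_forall fun y => ?_)
    rw [Real.norm_of_nonneg (hp_pos y₀).le]
    exact hy₀ (mem_univ y)
  exact (integrable_const_iff_isFiniteMeasure (hp_pos y₀).ne').1 hc

lemma volumeFunctional_pos [OpensMeasurableSpace M] [IsFiniteMeasure vol] [NeZero vol]
    (d : ℕ) (hp : Continuous p) (hp_pos : ∀ y, 0 < p y) : 0 < volumeFunctional vol d p := by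
  have hc : Continuous fun y => p y ^ (((d : ℝ) - 2) / d) :=
    hp.rpow_const fun y => Or.inl (hp_pos y).ne'
  have hi : Integrable (fun y => p y ^ (((d : ℝ) - 2) / d)) vol :=
    hc.integrable_of_hasCompactSupport (HasCompactSupport.of_compactSpace _)
  rw [volumeFunctional, integral_pos_iff_support_of_nonneg
    (fun y => (Real.rpow_pos_of_pos (hp_pos y) _).le) hi]
  have : Function.support (fun y => p y ^ (((d : ℝ) - 2) / d)) = univ :=
    eq_univ_of_forall fun y => (Real.rpow_pos_of_pos (hp_pos y) _).ne'
  rw [this]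
  exact Measure.measure_univ_pos.2 (NeZero.ne vol)

end Compact

/-! ### From the rescaled error to the ratio. -/

section Final

lemma edist_eq_ofReal_abs_sub_one {a : ℝ≥0∞} (ha : a ≠ ⊤) :
    edist a 1 = ENNReal.ofReal |a.toReal - 1| := by
  lift a to NNReal using ha
  change edist a 1 = _
  rw [edist_dist, NNReal.dist_eq]
  rfl

lemma representationGap_range_eq {M : Type*} [EMetricSpace M] [MeasurableSpace M] [BorelSpace M]
    {vol : Measure M} {p : M → ℝ} (hp : Measurable p) {n : ℕ} (z : Fin n → M) :
    representationGap vol p (range z) =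
      ∫⁻ y, ⨅ i, edist y (z i) ^ 2 ∂(vol.withDensity fun y => ENNReal.ofReal (p y)) := by
  rw [lintegral_withDensity_eq_lintegral_mul _ (by fun_prop) (measurable_iInf_edist_sq z),
    representationGap]
  refine lintegral_congr fun y => ?_
  rw [iInf_range, Pi.mul_apply, mul_comm]

/-- Convergence in probability of an extended nonnegative random variable, after rescaling. -/
lemma equivInProbability_of_tendsto {Ω : Type*} [MeasurableSpace Ω] {P : Measure Ω}
    {X : ℕ → Ω → ℝ≥0∞} {b : ℕ → ℝ} {l : ℝ} (hl : 0 < l) (hb : ∀ᶠ n in atTop, 0 < b n)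
    (h : ∀ ε > 0, Tendsto (fun n => P {w | ENNReal.ofReal (b n) * X n w = ⊤ ∨
      ε ≤ |(ENNReal.ofReal (b n) * X n w).toReal - l|}) atTop (𝓝 0)) :
    EquivInProbability P X fun n => l / b n := by
  refine tendstoInMeasure_of_ne_top fun ε hε hε_top => ?_
  have hε' : 0 < ε.toReal := ENNReal.toReal_pos hε.ne' hε_top
  -- The ratio equals `b n * X n / l`, so a deviation `ε` of the ratio from 1 is a deviation `ε * l`
  -- of `b n * X n` from `l`.
  refine tendsto_of_tendsto_of_tendsto_of_le_of_le' tendsto_const_nhds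
    (h (ε.toReal * l) (by positivity)) (Eventually.of_forall fun n => zero_le) ?_
  filter_upwards [hb] with n hn
  refine measure_mono fun w hw => ?_
  have hw' : ε ≤ edist (X n w / ENNReal.ofReal (l / b n)) 1 := hw
  -- Since `toReal` sends `⊤` to 0, infinite values are a separate alternative of the bad event.
  by_cases htop : ENNReal.ofReal (b n) * X n w = ⊤
  · exact Or.inl htop
  refine Or.inr ?_
  have hl0 : ENNReal.ofReal l ≠ 0 := (ENNReal.ofReal_pos.2 hl).ne'
  have hquot : X n w / ENNReal.ofReal (l / b n) =
      ENNReal.ofReal (b n) * X n w / ENNReal.ofReal l := by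
    rw [ENNReal.ofReal_div_of_pos hn, div_eq_mul_inv, ENNReal.inv_div (Or.inl ENNReal.ofReal_ne_top)
      (Or.inl (ENNReal.ofReal_pos.2 hn).ne'), ← mul_div_assoc, mul_comm]
  rw [hquot, edist_eq_ofReal_abs_sub_one (ENNReal.div_ne_top htop hl0), ENNReal.toReal_div,
    ENNReal.toReal_ofReal hl.le, ENNReal.le_ofReal_iff_toReal_le hε_top (abs_nonneg _)] at hw'
  calc ε.toReal * l ≤ |(ENNReal.ofReal (b n) * X n w).toReal / l - 1| * l := by gcongr
    _ = |(ENNReal.ofReal (b n) * X n w).toReal - l| := by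
      rw [← abs_of_pos hl, ← abs_mul, abs_of_pos hl, sub_mul, div_mul_cancel₀ _ hl.ne', one_mul]

end Final

end RepresentationGap

theorem mainTheorem2 {d : ℕ} (hd : 0 < d)
    -- `M` is a compact `d`-dimensional smooth Riemannian manifold without boundary
    {M : Type*} [EMetricSpace M] [ChartedSpace (EuclideanSpace ℝ (Fin d)) M]
    [IsManifold (𝓡 d) ∞ M]
    [RiemannianBundle (fun x : M => TangentSpace (𝓡 d) x)]
    [IsContMDiffRiemannianBundle (𝓡 d) ∞ (EuclideanSpace ℝ (Fin d))
      (fun x : M => TangentSpace (𝓡 d) x)]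
    [IsRiemannianManifold (𝓡 d) M]
    [CompactSpace M] [MeasurableSpace M] [BorelSpace M]
    -- `p` is a continuous, strictly positive probability density
    (p : M → ℝ) (hp_cont : Continuous p) (hp_pos : ∀ y, 0 < p y)
    (hp_int : ∫ y, p y ∂(RepresentationGap.riemannianVolume d M) = 1)
    -- for each `n`, the dataset `Z n 0, …, Z n (n - 1)` consists of `n` i.i.d. samples of law `p`
    {Ω : Type*} [MeasurableSpace Ω] (P : Measure Ω) [IsProbabilityMeasure P]
    (Z : (n : ℕ) → Fin n → Ω → M)
    (hZ_law : ∀ n i, HasLaw (Z n i)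
      ((RepresentationGap.riemannianVolume d M).withDensity fun y => ENNReal.ofReal (p y)) P)
    (hZ_indep : ∀ n, iIndepFun (Z n) P) :
    RepresentationGap.EquivInProbability P
      (fun n w => RepresentationGap.representationGap (RepresentationGap.riemannianVolume d M) p
        (Set.range fun i => Z n i w))
      (fun n => RepresentationGap.constJ d *
        RepresentationGap.volumeFunctional (RepresentationGap.riemannianVolume d M) d p /
          (n : ℝ) ^ (2 / (d : ℝ))) := by
  have hd' : (0 : ℝ) < d := by exact_mod_cast hd
  have : Nonempty M := RepresentationGap.nonempty_of_integral_eq_one hp_int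
  have : IsFiniteMeasure (RepresentationGap.riemannianVolume d M) :=
    RepresentationGap.isFiniteMeasure_of_integral_eq_one hp_cont hp_pos hp_int
  have := RepresentationGap.isProbabilityMeasure_withDensity_of_integral_eq_one hp_pos hp_int
  have : NeZero (RepresentationGap.riemannianVolume d M) := by
    refine ⟨fun h => ?_⟩
    rw [h, integral_zero_measure] at hp_int
    exact zero_ne_one hp_int
  have : IsContinuousRiemannianBundle (EuclideanSpace ℝ (Fin d))
      (fun x : M => TangentSpace (𝓡 d) x) :=
    RepresentationGap.isContinuousRiemannianBundle_of_isContMDiffRiemannianBundle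
      (IB := 𝓡 d) (n := ∞)
  obtain ⟨c, hc, δ, hδ, hlow⟩ :=
    RepresentationGap.exists_mul_pow_le_withDensity_eball (d := d) hp_cont hp_pos
  have hL := RepresentationGap.toReal_lintegral_exp_neg_eq (d := d)
    (vol := RepresentationGap.riemannianVolume d M) hd hp_cont.measurable hp_pos
  refine RepresentationGap.equivInProbability_of_tendsto
    (mul_pos (RepresentationGap.constJ_pos hd)
      (RepresentationGap.volumeFunctional_pos d hp_cont hp_pos)) ?_ fun ε hε => ?_
  · filter_upwards [eventually_gt_atTop 0] with n hn
    have hn' : (0 : ℝ) < n := by exact_mod_cast hn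
    positivity
  rw [← hL]
  simp only [RepresentationGap.representationGap_range_eq hp_cont.measurable]
  -- A law only makes the samples almost everywhere measurable; measurable versions have the same
  -- law and independence and almost surely the same error.
  have hae : ∀ n, ∀ᵐ w ∂P, ∀ i, Z n i w = (hZ_law n i).aemeasurable.mk (Z n i) w := fun n =>
    ae_all_iff.2 fun i => (hZ_law n i).aemeasurable.ae_eq_mk
  refine (RepresentationGap.tendsto_measure_nearest_sample hd
    (f := fun y => volume.real (Metric.ball (0 : EuclideanSpace ℝ (Fin d)) 1) * p y) (by fun_prop)
    (RepresentationGap.tendsto_withDensity_eball_div_pow hp_cont hp_pos) hc hδ hlow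
    (Z := fun n i => (hZ_law n i).aemeasurable.mk (Z n i))
    (fun n i => (hZ_law n i).aemeasurable.measurable_mk)
    (fun n i => (hZ_law n i).congr (hZ_law n i).aemeasurable.ae_eq_mk.symm)
    (fun n => (hZ_indep n).congr fun i => (hZ_law n i).aemeasurable.ae_eq_mk) hε).congr fun n => ?_
  refine measure_congr ?_
  filter_upwards [hae n] with w hw
  have hw' : (fun i => (hZ_law n i).aemeasurable.mk (Z n i) w) = fun i => Z n i w :=
    funext fun i => (hw i).symm
  exact congrArg (fun z : Fin n → M => (ENNReal.ofReal ((n : ℝ) ^ (2 / (d : ℝ))) *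
      ∫⁻ y, ⨅ i, edist y (z i) ^ 2 ∂((RepresentationGap.riemannianVolume d M).withDensity
        fun y => ENNReal.ofReal (p y)) = ⊤ ∨
    ε ≤ |(ENNReal.ofReal ((n : ℝ) ^ (2 / (d : ℝ))) *
      ∫⁻ y, ⨅ i, edist y (z i) ^ 2 ∂((RepresentationGap.riemannianVolume d M).withDensity
        fun y => ENNReal.ofReal (p y))).toReal - _|)) hw'
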